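/- Let $p\ge 2$ and $n\ge 0$ be integers. For a ring $A$ let $\mathscr H_A$ be the ring of Hahn series $\sum_{\gamma\in\mathbb Q}f_\gamma z^\gamma$ with coefficients in $A$ and well-ordered support in $\mathbb Q$, with the endomorphism $\phi_p(\sum f_\gamma z^\gamma)=\sum f_\gamma z^{p\gamma}$ and the $z$-adic valuation $\operatorname{val}_z$; put $\mathscr H=\mathscr H_{\mathbb C}$. Let $$L=a_n\phi_p^n+\cdots+a_1\phi_p+a_0,\qquad a_i\in\mathscr H,\ a_0a_n\neq 0 .$$ **Rings.** Let $\mathscr R_\lambda=\mathscr H_{\mathbb C(\lambda)}[X,\partial_\lambda X,\partial_\lambda^2X,\dots]$ be the ring of differential polynomials, where $\partial_\lambda$ acts on $\mathscr H_{\mathbb C(\lambda)}$ coefficientwise; extend $\phi_p$ to $\mathscr R_\lambda$ by $\phi_p(\partial_\lambda^iX)=\partial_\lambda^i(\lambda X)$, and write $e_\lambda=X$, $\ell_{\lambda,i}=\partial_\lambda^iX/i!$. Let $\mathscr R$ be any (commutative) difference ring extension of $(\mathscr H,\phi_p)$ with nonzero elements $\ell_{c,i}\in\mathscr R$ ($c\in\mathbb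 C^\times$, $i\ge 0$) such that $\phi_p(\ell_{c,i})=c\,\ell_{c,i}+\ell_{c,i-1}$, where $\ell_{c,-1}=0$. For $c\in\mathbb C^\times$ let $\mathbb C[\lambda]_{(\lambda-c)}$ be the ring of rational functions without pole at $c$, let $\mathscr R_{\lambda,c}=\mathscr H_{\mathbb C[\lambda]_{(\lambda-c)}}[\ell_{\lambda,0},\ell_{\lambda,1},\dots]\subset\mathscr R_\lambda$, and let $\operatorname{ev}_c:\mathscr R_{\lambda,c}\to\mathscr R$ be the ring morphism with $\operatorname{ev}_c(f(\lambda,z))=f(c,z)$ on coefficients and $\operatorname{ev}_c(\ell_{\lambda,i})=\ell_{c,i}$. **Slopes and exponents.** The Newton polygon of $L$ is the convex hull in $\mathbb R^2$ of $\{(p^i,y): 0\le i\le n,\ a_i\ne 0,\ y\in\mathbb R,\ y\ge\operatorname{val}_z(a_i)\}$. Let $(p^{\alpha_i},\operatorname{val}_z(a_{\alpha_i}))$, $0\le i\le k$, be its vertices, with $0=\alpha_0<\cdots<\alpha_k=n$. The slopes of $L$ are, for $1\le j\le k$, $$\mu_j=\frac{\operatorname{val}_z(a_{\alpha_j})-\operatorname{val}_z(a_{\alpha_{j-1}})}{p^{\alpha_j}-p^{\alpha_{j-1}}},\qquad\text{with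 multiplicity } r_j=\alpha_j-\alpha_{j-1}.$$ Put $b_i=z^{-(p^i-1)\mu_j}a_i$, $v=\min_{0\le i\le n}\operatorname{val}_z(b_i)$ and $\chi_j(T)=\sum_{i=0}^n (z^{-v}b_i)_{|z=0}\,T^i\in\mathbb C[T]$. The exponents attached to $\mu_j$ are the roots of $\chi_j$ in $\mathbb C^\times$; for $c\in\mathbb C^\times$ let $m_{c,j}\ge 0$ be the multiplicity of $c$ as a root of $\chi_j$. Put $$s_{c,j}=\sum_{i=1}^{j-1}m_{c,i},\qquad \nu_j=(p-1)\Bigl(\mu_1+\sum_{i=2}^{j}p^{\,r_1+\cdots+r_{i-1}}(\mu_i-\mu_{i-1})\Bigr).$$ **Theorem.** For every $j\in\{1,\dots,k\}$ and every exponent $c$ attached to $\mu_j$, there is a unique $g_{c,j}\in\mathscr H_{\mathbb C(\lambda)}$ such that in $\mathscr R_\lambda$ $$L(g_{c,j}\,e_\lambda)=z^{\operatorname{val}_z(a_0)-\frac{\nu_j}{p-1}}(\lambda-c)^{s_{c,j}+m_{c,j}}\,e_\lambda ;$$ it satisfies $\operatorname{val}_z(g_{c,j})=-\mu_j$, and its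 coefficients have no pole at $\lambda=c$. For $0\le m<m_{c,j}$ the element $\partial_\lambda^{s_{c,j}+m}(g_{c,j}e_\lambda)$ belongs to $\mathscr R_{\lambda,c}$, and $$y_{c,j,m}=\operatorname{ev}_c\bigl(\partial_\lambda^{s_{c,j}+m}(g_{c,j}e_\lambda)\bigr)\in\mathscr R$$ is a solution of $L(y)=0$. There are exactly $n$ triples $(c,j,m)$ with $1\le j\le k$, $c$ an exponent attached to $\mu_j$ and $0\le m<m_{c,j}$, and the $n$ solutions $y_{c,j,m}$ are $\mathbb C$-linearly independent. -/

import Mathlib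

noncomputable section

namespace MahlerFrobenius

/-! ## Hahn series with value group `ℚ` -/

/-- The field of Hahn series with complex coefficients and value group `ℚ`. -/
abbrev Hahn : Type := HahnSeries ℚ ℂ

/-- The field of Hahn series with coefficients in `ℂ(lambda)` and value group `ℚ`. -/
abbrev HahnLam : Type := HahnSeries ℚ (RatFunc ℂ)

/-- The monomial `z ^ γ`. -/
def zPow (A : Type*) [Semiring A] (γ : ℚ) : HahnSeries ℚ A := HahnSeries.single γ 1

/-- The ring morphism between rings of Hahn series induced by a morphism of coefficient rings. -/
def hahnMap {A B : Type*} [Semiring A] [Semiring B] (f : A →+* B) :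
    HahnSeries ℚ A →+* HahnSeries ℚ B where
  toFun x := x.map f
  map_zero' := by ext; simp
  map_one' := by
    ext γ
    by_cases h : γ = 0 <;> simp [HahnSeries.coeff_one, h]
  map_add' x y := by ext; simp
  map_mul' x y := HahnSeries.map_mul (f : A →ₙ+* B)

/-- The Mahler operator `f(z) ↦ f(z ^ p)` on Hahn series. -/
def mahlerHahn (p : ℕ) (hp : 2 ≤ p) (A : Type*) [Semiring A] :
    HahnSeries ℚ A →+* HahnSeries ℚ A :=
  HahnSeries.embDomainRingHom (AddMonoidHom.mulLeft (p : ℚ))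
    (mul_right_injective₀ (by positivity))
    (fun _ _ => mul_le_mul_iff_right₀ (by positivity))

/-! ## The derivation with respect to `lambda` -/

/-- The derivative of a rational function, by the quotient rule. -/
def ratDerivFun (f : RatFunc ℂ) : RatFunc ℂ :=
  algebraMap (Polynomial ℂ) (RatFunc ℂ)
      (Polynomial.derivative f.num * f.denom - f.num * Polynomial.derivative f.denom) /
    algebraMap (Polynomial ℂ) (RatFunc ℂ) (f.denom ^ 2)

theorem ratDerivFun_div (a b : Polynomial ℂ) (hb : b ≠ 0) :
    ratDerivFun (algebraMap _ (RatFunc ℂ) a / algebraMap _ (RatFunc ℂ) b) =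
      algebraMap (Polynomial ℂ) (RatFunc ℂ)
          (Polynomial.derivative a * b - a * Polynomial.derivative b) /
        algebraMap (Polynomial ℂ) (RatFunc ℂ) (b ^ 2) := by
  set f : RatFunc ℂ := algebraMap _ (RatFunc ℂ) a / algebraMap _ (RatFunc ℂ) b with hf
  have hd : f.denom ≠ 0 := f.denom_ne_zero
  have hb' : algebraMap (Polynomial ℂ) (RatFunc ℂ) b ≠ 0 := by simpa using hb
  have hd' : algebraMap (Polynomial ℂ) (RatFunc ℂ) f.denom ≠ 0 := by simpa using hd
  have key : f.num * b = a * f.denom := by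
    apply RatFunc.algebraMap_injective ℂ
    rw [map_mul, map_mul, ← div_eq_div_iff hd' hb', RatFunc.num_div_denom]
  clear_value f
  have key' := congrArg Polynomial.derivative key
  simp only [Polynomial.derivative_mul] at key'
  unfold ratDerivFun
  generalize f.num = N at *
  generalize f.denom = D at *
  have hmain : (Polynomial.derivative N * D - N * Polynomial.derivative D) * b ^ 2 =
      (Polynomial.derivative a * b - a * Polynomial.derivative b) * D ^ 2 := by
    linear_combination (b * D) * key' -
      (Polynomial.derivative D * b + D * Polynomial.derivative b) * key
  rw [div_eq_div_iff, ← map_mul, ← map_mul, hmain]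
  · simpa using hd
  · simpa using hb

theorem ratDerivFun_add (f g : RatFunc ℂ) :
    ratDerivFun (f + g) = ratDerivFun f + ratDerivFun g := by
  induction f using RatFunc.induction_on with
  | _ a b hb =>
  induction g using RatFunc.induction_on with
  | _ c d hd =>
  have hb' : algebraMap (Polynomial ℂ) (RatFunc ℂ) b ≠ 0 := by simpa using hb
  have hd' : algebraMap (Polynomial ℂ) (RatFunc ℂ) d ≠ 0 := by simpa using hd
  rw [div_add_div _ _ hb' hd', ← map_mul, ← map_mul, ← map_mul, ← map_add,
    ratDerivFun_div _ _ (mul_ne_zero hb hd), ratDerivFun_div _ _ hb, ratDerivFun_div _ _ hd]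
  simp only [map_mul, map_add, map_sub, map_pow, Polynomial.derivative_mul]
  field_simp
  ring

/-- The derivation `d / d lambda` of `ℂ(lambda)`. -/
def ratDeriv : RatFunc ℂ →+ RatFunc ℂ := AddMonoidHom.mk' ratDerivFun ratDerivFun_add

theorem ratDeriv_mul (f g : RatFunc ℂ) :
    ratDeriv (f * g) = f * ratDeriv g + g * ratDeriv f := by
  change ratDerivFun (f * g) = f * ratDerivFun g + g * ratDerivFun f
  induction f using RatFunc.induction_on with
  | _ a b hb =>
  induction g using RatFunc.induction_on with
  | _ c d hd =>
  have hb' : algebraMap (Polynomial ℂ) (RatFunc ℂ) b ≠ 0 := by simpa using hb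
  have hd' : algebraMap (Polynomial ℂ) (RatFunc ℂ) d ≠ 0 := by simpa using hd
  rw [div_mul_div_comm, ← map_mul, ← map_mul,
    ratDerivFun_div _ _ (mul_ne_zero hb hd), ratDerivFun_div _ _ hb, ratDerivFun_div _ _ hd]
  simp only [map_mul, map_add, map_sub, map_pow, Polynomial.derivative_mul]
  field_simp
  ring

/-- The coefficientwise derivation with respect to `lambda` on `HahnLam`. -/
def hahnDeriv : HahnLam →+ HahnLam :=
  AddMonoidHom.mk' (fun f : HahnLam => f.map ratDeriv) (by intro f g; ext; simp)

theorem hahnDeriv_mul (f g : HahnLam) :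
    hahnDeriv (f * g) = f * hahnDeriv g + g * hahnDeriv f := by
  change HahnSeries.map (f * g) ratDeriv = f * g.map ratDeriv + g * f.map ratDeriv
  have hsub : ∀ h : HahnLam, (h.map ratDeriv).support ⊆ h.support := by
    intro h γ hγ h0
    apply hγ
    simp only [HahnSeries.map_coeff]
    rw [h0, map_zero]
  ext γ
  rw [mul_comm g, HahnSeries.coeff_add, HahnSeries.map_coeff, HahnSeries.coeff_mul,
    HahnSeries.coeff_mul_right' g.isPWO_support (hsub g),
    HahnSeries.coeff_mul_left' f.isPWO_support (hsub f), map_sum, ← Finset.sum_add_distrib]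
  refine Finset.sum_congr rfl fun ij _ => ?_
  simp [ratDeriv_mul, mul_comm]

/-! ## The differential-difference ring of differential polynomials -/

/-- The ring of differential polynomials over `HahnLam` in one differential indeterminate;
the variable of index `i` is the `i`-th derivative of the indeterminate. -/
abbrev RLam : Type := MvPolynomial ℕ HahnLam

/-- The element `e_lambda`, that is, the differential indeterminate itself. -/
def eLam : RLam := MvPolynomial.X 0

/-- Derivation of the coefficients of a differential polynomial. -/
def coeffDeriv (P : RLam) : RLam :=
  ∑ m ∈ P.support, MvPolynomial.monomial m (hahnDeriv (P.coeff m))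

theorem coeff_coeffDeriv (P : RLam) (m : ℕ →₀ ℕ) :
    (coeffDeriv P).coeff m = hahnDeriv (P.coeff m) := by
  classical
  unfold coeffDeriv
  rw [MvPolynomial.coeff_sum]
  simp only [MvPolynomial.coeff_monomial]
  rw [Finset.sum_ite_eq']
  split_ifs with h
  · rfl
  · rw [MvPolynomial.notMem_support_iff.mp h, map_zero]

theorem coeffDeriv_add (P Q : RLam) : coeffDeriv (P + Q) = coeffDeriv P + coeffDeriv Q := by
  ext1 m
  simp [coeff_coeffDeriv]

theorem coeffDeriv_mul (P Q : RLam) :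
    coeffDeriv (P * Q) = P * coeffDeriv Q + Q * coeffDeriv P := by
  classical
  ext1 m
  rw [coeff_coeffDeriv, mul_comm Q, MvPolynomial.coeff_add, MvPolynomial.coeff_mul,
    MvPolynomial.coeff_mul, MvPolynomial.coeff_mul, map_sum, ← Finset.sum_add_distrib]
  refine Finset.sum_congr rfl fun ij _ => ?_
  simp [coeff_coeffDeriv, hahnDeriv_mul, mul_comm]

/-- The derivation of `RLam` extending the derivation of `HahnLam` and sending the variable of
index `i` to the variable of index `i + 1`. -/
def dLam : RLam →+ RLam :=
  AddMonoidHom.mk'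
    (fun P : RLam => coeffDeriv P +
      MvPolynomial.mkDerivation HahnLam (fun i => (MvPolynomial.X (i + 1) : RLam)) P)
    (by intro P Q; simp only [coeffDeriv_add, map_add]; ring)

theorem dLam_apply (P : RLam) : dLam P = coeffDeriv P +
    MvPolynomial.mkDerivation HahnLam (fun i => (MvPolynomial.X (i + 1) : RLam)) P := rfl

theorem dLam_mul (P Q : RLam) : dLam (P * Q) = P * dLam Q + Q * dLam P := by
  simp only [dLam_apply, coeffDeriv_mul, Derivation.leibniz, smul_eq_mul]
  ring

theorem dLam_C (f : HahnLam) : dLam (MvPolynomial.C f) = MvPolynomial.C (hahnDeriv f) := by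
  classical
  rw [dLam_apply, MvPolynomial.derivation_C, add_zero]
  ext1 m
  rw [coeff_coeffDeriv, MvPolynomial.coeff_C, MvPolynomial.coeff_C]
  split_ifs <;> simp

theorem dLam_X (i : ℕ) : dLam (MvPolynomial.X i) = MvPolynomial.X (i + 1) := by
  classical
  have h1 : hahnDeriv 1 = 0 := by
    have := hahnDeriv_mul 1 1
    simpa using this
  have h0 : coeffDeriv (MvPolynomial.X i) = 0 := by
    ext1 m
    rw [coeff_coeffDeriv, MvPolynomial.coeff_X, MvPolynomial.coeff_zero]
    split_ifs
    · exact h1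
    · exact map_zero _
  rw [dLam_apply, MvPolynomial.mkDerivation_X, h0, zero_add]

/-- The rational function `lambda`, as an element of `RLam`. -/
def lam : RLam := MvPolynomial.C (HahnSeries.C RatFunc.X)

/-- The Mahler operator on `RLam`: it extends the one on `HahnLam` and sends the `i`-th derivative
of the indeterminate `X` to the `i`-th derivative of `lambda * X`. -/
def mahlerLam (p : ℕ) (hp : 2 ≤ p) : RLam →+* RLam :=
  MvPolynomial.eval₂Hom (MvPolynomial.C.comp (mahlerHahn p hp (RatFunc ℂ)))
    (fun i => dLam^[i] (lam * eLam))

/-- The inclusion of the ring of Hahn series over `ℂ` into `RLam`. -/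
def hahnToRLam : Hahn →+* RLam :=
  MvPolynomial.C.comp (hahnMap (algebraMap ℂ (RatFunc ℂ)))

/-! ## Evaluation at `lambda = c` -/

/-- The ring of rational functions without pole at `c`. -/
def regularAt (c : ℂ) : Subring (RatFunc ℂ) where
  carrier := {f | f.denom.eval c ≠ 0}
  zero_mem' := by simp
  one_mem' := by simp
  add_mem' {f g} hf hg := by
    intro h
    have := Polynomial.eval_eq_zero_of_dvd_of_eval_eq_zero (RatFunc.denom_add_dvd f g) h
    rw [Polynomial.eval_mul] at this
    exact (mul_ne_zero hf hg) this
  mul_mem' {f g} hf hg := by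
    intro h
    have := Polynomial.eval_eq_zero_of_dvd_of_eval_eq_zero (RatFunc.denom_mul_dvd f g) h
    rw [Polynomial.eval_mul] at this
    exact (mul_ne_zero hf hg) this
  neg_mem' {f} hf := by
    intro h
    have hd : (-f).denom ∣ f.denom := by
      rw [RatFunc.denom_dvd f.denom_ne_zero]
      exact ⟨-f.num, by rw [map_neg, neg_div, RatFunc.num_div_denom]⟩
    exact hf (Polynomial.eval_eq_zero_of_dvd_of_eval_eq_zero hd h)

/-- The value at `c` of a rational function without pole at `c`. -/
def evalRat (c : ℂ) : regularAt c →+* ℂ where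
  toFun f := RatFunc.eval (RingHom.id ℂ) c (f : RatFunc ℂ)
  map_zero' := by simp
  map_one' := by simp
  map_add' f g := RatFunc.eval_add (f := RingHom.id ℂ) (a := c) f.2 g.2
  map_mul' f g := RatFunc.eval_mul (f := RingHom.id ℂ) (a := c) f.2 g.2

/-- The ring of differential polynomials whose coefficients are Hahn series over the ring of rational
functions without pole at `c`. -/
abbrev RLamAt (c : ℂ) : Type := MvPolynomial ℕ (HahnSeries ℚ (regularAt c))

/-- The inclusion of `RLamAt c` into `RLam`. -/
def inclAt (c : ℂ) : RLamAt c →+* RLam := MvPolynomial.map (hahnMap (regularAt c).subtype)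

theorem inclAt_injective (c : ℂ) : Function.Injective (inclAt c) := by
  apply MvPolynomial.map_injective
  intro f g h
  ext γ
  exact congrArg (fun x : HahnLam => x.coeff γ) h

/-- Evaluation at `lambda = c`, with values in an algebra `R` over the Hahn series, given a sequence
`ell` of elements of `R`. It evaluates the coefficients at `c` and sends the element
`ell_{lambda, i}`, which is `1 / i !` times the variable of index `i`, to `ell i`. -/
def ev {R : Type*} [CommRing R] [Algebra Hahn R] (c : ℂ) (ell : ℕ → R) : RLamAt c →+* R :=
  MvPolynomial.eval₂Hom ((algebraMap Hahn R).comp (hahnMap (evalRat c)))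
    (fun i => (Nat.factorial i : R) * ell i)

/-! ## Mahler operators, Newton polygons, slopes and exponents

A Mahler operator `a_n φ^n + ⋯ + a_0` is given by `n` and by its sequence of coefficients, of which
only those of index at most `n` are used. -/

/-- The value at `y` of the Mahler operator with coefficients `a_0, …, a_n` acting on a ring `A` with
endomorphism `σ` and structure morphism `ι` from the Hahn series. -/
def mahlerApply {A : Type*} [CommRing A] (ι : Hahn →+* A) (σ : A →+* A) (n : ℕ) (a : ℕ → Hahn)
    (y : A) : A :=
  ∑ i ∈ Finset.range (n + 1), ι (a i) * σ^[i] y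

/-- The Newton polygon. For a nonzero Hahn series, `HahnSeries.order` is the `z`-adic valuation. -/
def newtonPolygon (p n : ℕ) (a : ℕ → Hahn) : Set (ℝ × ℝ) :=
  convexHull ℝ {P | ∃ i ≤ n, a i ≠ 0 ∧ P.1 = (p : ℝ) ^ i ∧ ((a i).order : ℝ) ≤ P.2}

/-- The index `i` gives a vertex `(p ^ i, val (a i))` of the Newton polygon. -/
def IsVertex (p n : ℕ) (a : ℕ → Hahn) (i : ℕ) : Prop :=
  i ≤ n ∧ a i ≠ 0 ∧ ((p : ℝ) ^ i, ((a i).order : ℝ)) ∈ (newtonPolygon p n a).extremePoints ℝ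

/-- The increasing sequence `α_0 < ⋯ < α_k` of the indices of the vertices. -/
def vertexIndex (p n : ℕ) (a : ℕ → Hahn) (j : ℕ) : ℕ := Nat.nth (IsVertex p n a) j

/-- The number `k` of slopes; the slopes are numbered from `1` to `k`. -/
def numSlopes (p n : ℕ) (a : ℕ → Hahn) : ℕ := {i | IsVertex p n a i}.ncard - 1

/-- The `j`-th slope `μ_j`, for `1 ≤ j ≤ k`. -/
def slope (p n : ℕ) (a : ℕ → Hahn) (j : ℕ) : ℚ :=
  ((a (vertexIndex p n a j)).order - (a (vertexIndex p n a (j - 1))).order) /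
    ((p : ℚ) ^ vertexIndex p n a j - (p : ℚ) ^ vertexIndex p n a (j - 1))

/-- The multiplicity `r_j = α_j - α_{j-1}` of the `j`-th slope, for `1 ≤ j ≤ k`. -/
def slopeMult (p n : ℕ) (a : ℕ → Hahn) (j : ℕ) : ℕ :=
  vertexIndex p n a j - vertexIndex p n a (j - 1)

/-- The coefficients of the conjugate of the operator by `θ_μ = z ^ (μ / (p - 1))`. -/
def gauge (p : ℕ) (a : ℕ → Hahn) (μ : ℚ) (i : ℕ) : Hahn :=
  zPow ℂ (((p : ℚ) ^ i - 1) / ((p : ℚ) - 1) * μ) * a i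

/-- The minimum of the `z`-adic valuations of the coefficients `b_0, …, b_n`, not all zero. -/
def opVal (n : ℕ) (b : ℕ → Hahn) : ℚ :=
  ((Finset.range (n + 1)).inf fun i => (b i).orderTop).untopD 0

/-- The characteristic polynomial attached to the `j`-th slope. -/
def charPoly (p n : ℕ) (a : ℕ → Hahn) (j : ℕ) : Polynomial ℂ :=
  let b := gauge p a (-(((p : ℚ) - 1) * slope p n a j))
  ∑ i ∈ Finset.range (n + 1), Polynomial.monomial i ((zPow ℂ (-opVal n b) * b i).coeff 0)

/-- The multiplicity `m_{c,j}` of `c` as an exponent attached to the `j`-th slope; it is zero if `c` is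
not an exponent attached to this slope. -/
def expMult (p n : ℕ) (a : ℕ → Hahn) (c : ℂˣ) (j : ℕ) : ℕ :=
  (charPoly p n a j).rootMultiplicity (c : ℂ)

/-- The nonzero complex number `c` is an exponent attached to the `j`-th slope. -/
def IsExponent (p n : ℕ) (a : ℕ → Hahn) (c : ℂˣ) (j : ℕ) : Prop :=
  (charPoly p n a j).IsRoot (c : ℂ)

/-- The integer `s_{c,j} = m_{c,1} + ⋯ + m_{c,j-1}`. -/
def expShift (p n : ℕ) (a : ℕ → Hahn) (c : ℂˣ) (j : ℕ) : ℕ :=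
  ∑ i ∈ Finset.Ico 1 j, expMult p n a c i

/-- The rational number
`ν_j = (p - 1) (p^(r_1 + ⋯ + r_{j-1}) (μ_j - μ_{j-1}) + ⋯ + p^(r_1) (μ_2 - μ_1) + μ_1)`. -/
def nu (p n : ℕ) (a : ℕ → Hahn) (j : ℕ) : ℚ :=
  ((p : ℚ) - 1) *
    (∑ i ∈ Finset.Icc 2 j,
        (p : ℚ) ^ (∑ l ∈ Finset.Ico 1 i, slopeMult p n a l) * (slope p n a i - slope p n a (i - 1)) +
      slope p n a 1)

/-- The equation `L(g e_lambda) = z^(val a_0 - ν_j / (p - 1)) (lambda - c)^(s_{c,j} + m_{c,j}) e_lambda`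
in `RLam`, where `g` is a Hahn series with coefficients in `ℂ(lambda)`. -/
def IsFrobeniusSeries (p : ℕ) (hp : 2 ≤ p) (n : ℕ) (a : ℕ → Hahn) (c : ℂˣ) (j : ℕ)
    (g : HahnLam) : Prop :=
  mahlerApply hahnToRLam (mahlerLam p hp) n a (MvPolynomial.C g * eLam) =
    hahnToRLam (zPow ℂ ((a 0).order - nu p n a j / ((p : ℚ) - 1))) *
      (lam - hahnToRLam (HahnSeries.C (c : ℂ))) ^ (expShift p n a c j + expMult p n a c j) * eLam

/-- The triples `(c, j, m)` such that `1 ≤ j ≤ k`, `c` is an exponent attached to the `j`-th slope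
and `m < m_{c,j}`. -/
def frobeniusIndex (p n : ℕ) (a : ℕ → Hahn) : Set (ℂˣ × ℕ × ℕ) :=
  {t | 1 ≤ t.2.1 ∧ t.2.1 ≤ numSlopes p n a ∧ IsExponent p n a t.1 t.2.1 ∧
    t.2.2 < expMult p n a t.1 t.2.1}

end MahlerFrobenius

end

noncomputable section

namespace MahlerFrobenius

/-! ## The combinatorics of the Newton polygon -/

/-- The index `i` is the only one at which `val (a_l) + p ^ l * γ` is minimal. -/
def StrictMin (p n : ℕ) (a : ℕ → Hahn) (i : ℕ) (γ : ℚ) : Prop :=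
  i ≤ n ∧ a i ≠ 0 ∧ ∀ l ≤ n, a l ≠ 0 → l ≠ i →
    (a i).order + (p : ℚ) ^ i * γ < (a l).order + (p : ℚ) ^ l * γ

/-- The minimum of `val (a_l) + p ^ l * γ` is equal to `δ`. -/
def Touches (p n : ℕ) (a : ℕ → Hahn) (γ δ : ℚ) : Prop :=
  (∀ i ≤ n, a i ≠ 0 → δ ≤ (a i).order + (p : ℚ) ^ i * γ) ∧
    ∃ i ≤ n, a i ≠ 0 ∧ (a i).order + (p : ℚ) ^ i * γ = δ

section Newton

variable {p n : ℕ} {a : ℕ → Hahn}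

theorem pow_lt_pow_cast (hp : 2 ≤ p) {i l : ℕ} (h : i < l) : (p : ℚ) ^ i < (p : ℚ) ^ l :=
  pow_lt_pow_right₀ (by exact_mod_cast (by omega : 1 < p)) h

theorem pow_pos_cast (hp : 2 ≤ p) (i : ℕ) : (0 : ℚ) < (p : ℚ) ^ i :=
  pow_pos (by exact_mod_cast (by omega : 0 < p)) i

theorem convex_insert_openHalfSpace (γ : ℝ) (P : ℝ × ℝ) :
    Convex ℝ {Q : ℝ × ℝ | Q = P ∨ P.2 + γ * P.1 < Q.2 + γ * Q.1} := by
  intro x hx y hy s t hs ht hst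
  have hx' : P.2 + γ * P.1 ≤ x.2 + γ * x.1 := by
    rcases hx with rfl | hx
    · exact le_rfl
    · exact hx.le
  have hy' : P.2 + γ * P.1 ≤ y.2 + γ * y.1 := by
    rcases hy with rfl | hy
    · exact le_rfl
    · exact hy.le
  rcases hs.eq_or_lt with rfl | hs
  · obtain rfl : t = 1 := by linarith
    simpa using hy
  rcases ht.eq_or_lt with rfl | ht
  · obtain rfl : s = 1 := by linarith
    simpa using hx
  have hP : P.2 + γ * P.1 = s * (P.2 + γ * P.1) + t * (P.2 + γ * P.1) := by
    rw [← add_mul, hst, one_mul]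
  rcases hx with rfl | hx
  · rcases hy with rfl | hy
    · left
      rw [← add_smul, hst, one_smul]
    · right
      have := mul_lt_mul_of_pos_left hy ht
      simp only [Prod.snd_add, Prod.smul_snd, Prod.fst_add, Prod.smul_fst, smul_eq_mul]
      linarith
  · right
    have h1 := mul_lt_mul_of_pos_left hx hs
    have h2 := mul_le_mul_of_nonneg_left hy' ht.le
    simp only [Prod.snd_add, Prod.smul_snd, Prod.fst_add, Prod.smul_fst, smul_eq_mul]
    linarith

theorem mem_newtonPolygon {i : ℕ} (hi : i ≤ n) (ha : a i ≠ 0) {y : ℝ}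
    (hy : ((a i).order : ℝ) ≤ y) : ((p : ℝ) ^ i, y) ∈ newtonPolygon p n a :=
  subset_convexHull ℝ _ ⟨i, hi, ha, rfl, hy⟩

theorem StrictMin.isVertex {i : ℕ} {γ : ℚ} (h : StrictMin p n a i γ) : IsVertex p n a i := by
  obtain ⟨hi, ha, hmin⟩ := h
  refine ⟨hi, ha, mem_extremePoints.mpr ⟨mem_newtonPolygon hi ha le_rfl, ?_⟩⟩
  have hsub : newtonPolygon p n a ⊆ {Q : ℝ × ℝ | Q = ((p : ℝ) ^ i, ((a i).order : ℝ)) ∨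
      ((a i).order : ℝ) + γ * (p : ℝ) ^ i < Q.2 + γ * Q.1} := by
    refine convexHull_min ?_ (convex_insert_openHalfSpace γ ((p : ℝ) ^ i, ((a i).order : ℝ)))
    rintro ⟨x, y⟩ ⟨l, hl, hal, hx, hy⟩
    dsimp only at hx hy
    subst hx
    by_cases hli : l = i
    · subst hli
      rcases hy.eq_or_lt with h | h
      · left
        rw [h]
      · right
        dsimp only
        linarith
    · right
      have h1 : (((a i).order + (p : ℚ) ^ i * γ : ℚ) : ℝ) <
          (((a l).order + (p : ℚ) ^ l * γ : ℚ) : ℝ) := by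
        exact_mod_cast hmin l hl hal hli
      push_cast at h1
      dsimp only
      linarith
  intro x hx y hy hxy
  obtain ⟨s, t, hs, ht, hst, hP⟩ := hxy
  have hP1 : s * x.1 + t * y.1 = (p : ℝ) ^ i := congrArg Prod.fst hP
  have hP2 : s * x.2 + t * y.2 = ((a i).order : ℝ) := congrArg Prod.snd hP
  have hPP : ((a i).order : ℝ) + γ * (p : ℝ) ^ i =
      s * (x.2 + γ * x.1) + t * (y.2 + γ * y.1) := by
    rw [← hP1, ← hP2]; ring
  have hone : ((a i).order : ℝ) + γ * (p : ℝ) ^ i =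
      s * (((a i).order : ℝ) + γ * (p : ℝ) ^ i) + t * (((a i).order : ℝ) + γ * (p : ℝ) ^ i) := by
    rw [← add_mul, hst, one_mul]
  rcases hsub hx with hx | hx <;> rcases hsub hy with hy | hy
  · exact ⟨hx, hy⟩
  · have := mul_lt_mul_of_pos_left hy ht
    rw [hx] at hPP
    linarith
  · have := mul_lt_mul_of_pos_left hx hs
    rw [hy] at hPP
    linarith
  · have h1 := mul_lt_mul_of_pos_left hx hs
    have h2 := mul_lt_mul_of_pos_left hy ht
    linarith

theorem IsVertex.below_chord (hp : 2 ≤ p) {i : ℕ} (h : IsVertex p n a i) {l m : ℕ} (hl : l < i)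
    (hm : i < m) (hmn : m ≤ n) (hal : a l ≠ 0) (ham : a m ≠ 0) :
    ((a i).order - (a l).order) * ((p : ℚ) ^ m - (p : ℚ) ^ i) <
      ((a m).order - (a i).order) * ((p : ℚ) ^ i - (p : ℚ) ^ l) := by
  obtain ⟨hi, hai, hext⟩ := h
  by_contra! hcon
  have hli := sub_pos.mpr (pow_lt_pow_cast hp hl)
  have him := sub_pos.mpr (pow_lt_pow_cast hp hm)
  have hlm := sub_pos.mpr (pow_lt_pow_cast hp (hl.trans hm))
  have hD : ((p : ℚ) ^ m - (p : ℚ) ^ l) ≠ 0 := hlm.ne'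
  set s : ℚ := ((p : ℚ) ^ m - (p : ℚ) ^ i) / ((p : ℚ) ^ m - (p : ℚ) ^ l) with hs
  set t : ℚ := ((p : ℚ) ^ i - (p : ℚ) ^ l) / ((p : ℚ) ^ m - (p : ℚ) ^ l) with ht
  set e : ℚ := (a i).order - (s * (a l).order + t * (a m).order) with he
  have hst : s + t = 1 := by
    rw [hs, ht]; field_simp; ring
  have he0 : 0 ≤ e := by
    have : e = (((a i).order - (a l).order) * ((p : ℚ) ^ m - (p : ℚ) ^ i) -
      ((a m).order - (a i).order) * ((p : ℚ) ^ i - (p : ℚ) ^ l)) /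
        ((p : ℚ) ^ m - (p : ℚ) ^ l) := by
      rw [he, hs, ht]; field_simp; ring
    rw [this]
    exact div_nonneg (by linarith) hlm.le
  have h1 : s * (p : ℚ) ^ l + t * (p : ℚ) ^ m = (p : ℚ) ^ i := by
    rw [hs, ht]; field_simp; ring
  have h2 : s * ((a l).order + e) + t * ((a m).order + e) = (a i).order := by
    have : s * ((a l).order + e) + t * ((a m).order + e) =
      (s * (a l).order + t * (a m).order) + (s + t) * e := by ring
    rw [this, hst, he]; ring
  have he0' : (0 : ℝ) ≤ (e : ℝ) := by exact_mod_cast he0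
  have hx : ((p : ℝ) ^ l, ((a l).order : ℝ) + e) ∈ newtonPolygon p n a :=
    mem_newtonPolygon (by omega) hal (by linarith)
  have hy : ((p : ℝ) ^ m, ((a m).order : ℝ) + e) ∈ newtonPolygon p n a :=
    mem_newtonPolygon hmn ham (by linarith)
  have := ((mem_extremePoints.mp hext).2 _ hx _ hy ⟨s, t, ?_, ?_, ?_, ?_⟩).1
  · have h3 : (p : ℝ) ^ l = (p : ℝ) ^ i := congrArg Prod.fst this
    have h4 : (p : ℚ) ^ l = (p : ℚ) ^ i := by exact_mod_cast h3
    linarith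
  · have : 0 < s := div_pos him hlm
    exact_mod_cast this
  · have : 0 < t := div_pos hli hlm
    exact_mod_cast this
  · exact_mod_cast hst
  · ext
    · simp only [Prod.fst_add, Prod.smul_fst, smul_eq_mul]
      exact_mod_cast h1
    · simp only [Prod.snd_add, Prod.smul_snd, smul_eq_mul]
      exact_mod_cast h2

theorem IsVertex.exists_strictMin (hp : 2 ≤ p) {i : ℕ} (h : IsVertex p n a i) :
    ∃ γ, StrictMin p n a i γ := by
  classical
  let f : ℕ → ℚ := fun l => ((a i).order - (a l).order) / ((p : ℚ) ^ l - (p : ℚ) ^ i)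
  obtain ⟨γ, h1, h2⟩ := Order.exists_between_finsets
    (((Finset.range (n + 1)).filter fun m => a m ≠ 0 ∧ i < m).image f)
    (((Finset.range (n + 1)).filter fun m => a m ≠ 0 ∧ m < i).image f) (by
      simp only [Finset.mem_image, Finset.mem_filter, Finset.mem_range]
      rintro _ ⟨m, ⟨hmn, ham, hm⟩, rfl⟩ _ ⟨l, ⟨-, hal, hl⟩, rfl⟩
      have := h.below_chord hp hl hm (by omega) hal ham
      have hli := sub_pos.mpr (pow_lt_pow_cast hp hl)
      have him := sub_pos.mpr (pow_lt_pow_cast hp hm)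
      have hfl : f l = ((a l).order - (a i).order) / ((p : ℚ) ^ i - (p : ℚ) ^ l) := by
        change _ / _ = _
        rw [← neg_sub, ← neg_sub ((p : ℚ) ^ i), neg_div_neg_eq]
      rw [hfl, div_lt_div_iff₀ him hli]
      linarith)
  refine ⟨γ, h.1, h.2.1, fun l hl hal hli => ?_⟩
  rcases lt_or_gt_of_ne hli with hlt | hlt
  · have := h2 _ (Finset.mem_image_of_mem f (Finset.mem_filter.mpr
      ⟨Finset.mem_range.mpr (by omega), hal, hlt⟩))
    have hpos := sub_neg.mpr (pow_lt_pow_cast hp hlt)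
    rw [lt_div_iff_of_neg hpos] at this
    linarith
  · have := h1 _ (Finset.mem_image_of_mem f (Finset.mem_filter.mpr
      ⟨Finset.mem_range.mpr (by omega), hal, hlt⟩))
    have hpos := sub_pos.mpr (pow_lt_pow_cast hp hlt)
    rw [div_lt_iff₀ hpos] at this
    linarith

theorem Touches.lt_of_lt (hp : 2 ≤ p) {γ γ' δ δ' : ℚ} (h : Touches p n a γ δ)
    (h' : Touches p n a γ' δ') (hlt : γ < γ') : δ < δ' := by
  obtain ⟨i, hi, hai, rfl⟩ := h'.2
  have := h.1 i hi hai
  have := mul_lt_mul_of_pos_left hlt (pow_pos_cast hp i)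
  linarith

theorem Touches.le_of_le (hp : 2 ≤ p) {γ γ' δ δ' : ℚ} (h : Touches p n a γ δ)
    (h' : Touches p n a γ' δ') (hle : γ ≤ γ') : δ ≤ δ' := by
  obtain ⟨i, hi, hai, rfl⟩ := h'.2
  have := h.1 i hi hai
  have := mul_le_mul_of_nonneg_left hle (pow_pos_cast hp i).le
  linarith

theorem exists_touches_right (ha : a 0 ≠ 0) (γ : ℚ) : ∃ δ, Touches p n a γ δ := by
  classical
  obtain ⟨i, hi, hmin⟩ := Finset.exists_min_image ((Finset.range (n + 1)).filter fun i => a i ≠ 0)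
    (fun i => (a i).order + (p : ℚ) ^ i * γ) ⟨0, by simp [ha]⟩
  simp only [Finset.mem_filter, Finset.mem_range] at hi hmin
  exact ⟨_, fun l hl hal => hmin l ⟨by omega, hal⟩, i, by omega, hi.2, rfl⟩

theorem exists_touches_left (hp : 2 ≤ p) (ha : a 0 ≠ 0) (δ : ℚ) : ∃ γ, Touches p n a γ δ := by
  classical
  obtain ⟨i, hi, hmax⟩ := Finset.exists_max_image ((Finset.range (n + 1)).filter fun i => a i ≠ 0)
    (fun i => (δ - (a i).order) / (p : ℚ) ^ i) ⟨0, by simp [ha]⟩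
  simp only [Finset.mem_filter, Finset.mem_range] at hi hmax
  refine ⟨(δ - (a i).order) / (p : ℚ) ^ i, fun l hl hal => ?_, i, by omega, hi.2, ?_⟩
  · have := hmax l ⟨by omega, hal⟩
    rw [div_le_iff₀ (pow_pos_cast hp l)] at this
    linarith
  · rw [mul_div_cancel₀ _ (pow_pos_cast hp i).ne']
    ring

/-- The index `i` is the smallest and `l` the largest at which `val (a_m) + p ^ m * γ` takes its
minimal value `δ`. -/
def TouchesBetween (p n : ℕ) (a : ℕ → Hahn) (γ δ : ℚ) (i l : ℕ) : Prop :=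
  i ≤ l ∧ l ≤ n ∧ a i ≠ 0 ∧ a l ≠ 0 ∧ (a i).order + (p : ℚ) ^ i * γ = δ ∧
    (a l).order + (p : ℚ) ^ l * γ = δ ∧ ∀ m ≤ n, a m ≠ 0 → δ ≤ (a m).order + (p : ℚ) ^ m * γ ∧
      (m < i ∨ l < m → δ < (a m).order + (p : ℚ) ^ m * γ)

theorem TouchesBetween.touches {γ δ : ℚ} {i l : ℕ} (h : TouchesBetween p n a γ δ i l) :
    Touches p n a γ δ :=
  ⟨fun m hm ham => (h.2.2.2.2.2.2 m hm ham).1, l, h.2.1, h.2.2.2.1, h.2.2.2.2.2.1⟩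

theorem Touches.exists_touchesBetween {γ δ : ℚ} (h : Touches p n a γ δ) :
    ∃ i l, TouchesBetween p n a γ δ i l := by
  classical
  set S := (Finset.range (n + 1)).filter fun m => a m ≠ 0 ∧ (a m).order + (p : ℚ) ^ m * γ = δ
    with hS
  have hmem : ∀ m, m ∈ S ↔ m ≤ n ∧ a m ≠ 0 ∧ (a m).order + (p : ℚ) ^ m * γ = δ := by
    intro m
    simp [hS]
  obtain ⟨i₀, hi₀⟩ : S.Nonempty := by
    obtain ⟨i, hi, hai, hd⟩ := h.2
    exact ⟨i, (hmem i).mpr ⟨hi, hai, hd⟩⟩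
  obtain ⟨i, hi, hmin⟩ := S.exists_min_image id ⟨i₀, hi₀⟩
  obtain ⟨l, hl, hmax⟩ := S.exists_max_image id ⟨i₀, hi₀⟩
  have hi' := (hmem i).mp hi
  have hl' := (hmem l).mp hl
  refine ⟨i, l, hmin l hl, hl'.1, hi'.2.1, hl'.2.1, hi'.2.2, hl'.2.2,
    fun m hm ham => ⟨h.1 m hm ham, fun hout => (h.1 m hm ham).lt_of_ne fun heq => ?_⟩⟩
  have hmS := (hmem m).mpr ⟨hm, ham, heq.symm⟩
  have h1 := hmin m hmS
  have h2 := hmax m hmS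
  simp only [id] at h1 h2
  omega

theorem TouchesBetween.isVertex_right (hp : 2 ≤ p) {γ δ : ℚ} {i l : ℕ}
    (h : TouchesBetween p n a γ δ i l) : IsVertex p n a l := by
  classical
  obtain ⟨-, hl, -, hal, -, hd, hmin⟩ := h
  let f : ℕ → ℚ := fun m => ((a l).order - (a m).order) / ((p : ℚ) ^ m - (p : ℚ) ^ l)
  obtain ⟨γ', h1, h2⟩ := Order.exists_between_finsets
    (((Finset.range (n + 1)).filter fun m => a m ≠ 0 ∧ l < m).image f) {γ} (by
      simp only [Finset.mem_image, Finset.mem_filter, Finset.mem_range, Finset.mem_singleton]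
      rintro _ ⟨m, ⟨hmn, ham, hm⟩, rfl⟩ _ rfl
      have := (hmin m (by omega) ham).2 (Or.inr hm)
      rw [div_lt_iff₀ (sub_pos.mpr (pow_lt_pow_cast hp hm))]
      linarith)
  replace h2 := h2 γ (Finset.mem_singleton_self γ)
  refine StrictMin.isVertex (γ := γ') ⟨hl, hal, fun m hm ham hml => ?_⟩
  rcases lt_or_gt_of_ne hml with hlt | hlt
  · have := (hmin m hm ham).1
    have := mul_lt_mul_of_pos_left h2 (sub_pos.mpr (pow_lt_pow_cast hp hlt))
    linarith
  · have := h1 _ (Finset.mem_image_of_mem f (Finset.mem_filter.mpr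
      ⟨Finset.mem_range.mpr (by omega), ham, hlt⟩))
    rw [div_lt_iff₀ (sub_pos.mpr (pow_lt_pow_cast hp hlt))] at this
    linarith

theorem TouchesBetween.isVertex_left (hp : 2 ≤ p) {γ δ : ℚ} {i l : ℕ}
    (h : TouchesBetween p n a γ δ i l) : IsVertex p n a i := by
  classical
  obtain ⟨hil, hl, hai, -, hd, -, hmin⟩ := h
  let f : ℕ → ℚ := fun m => ((a m).order - (a i).order) / ((p : ℚ) ^ i - (p : ℚ) ^ m)
  obtain ⟨γ', h1, h2⟩ := Order.exists_between_finsets {γ}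
    (((Finset.range (n + 1)).filter fun m => a m ≠ 0 ∧ m < i).image f) (by
      simp only [Finset.mem_image, Finset.mem_filter, Finset.mem_range, Finset.mem_singleton]
      rintro _ rfl _ ⟨m, ⟨hmn, ham, hm⟩, rfl⟩
      have := (hmin m (by omega) ham).2 (Or.inl hm)
      rw [lt_div_iff₀ (sub_pos.mpr (pow_lt_pow_cast hp hm))]
      linarith)
  replace h1 := h1 γ (Finset.mem_singleton_self γ)
  refine StrictMin.isVertex (γ := γ') ⟨by omega, hai, fun m hm ham hml => ?_⟩
  rcases lt_or_gt_of_ne hml with hlt | hlt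
  · have := h2 _ (Finset.mem_image_of_mem f (Finset.mem_filter.mpr
      ⟨Finset.mem_range.mpr (by omega), ham, hlt⟩))
    rw [lt_div_iff₀ (sub_pos.mpr (pow_lt_pow_cast hp hlt))] at this
    linarith
  · have := (hmin m hm ham).1
    have := mul_lt_mul_of_pos_left h1 (sub_pos.mpr (pow_lt_pow_cast hp hlt))
    linarith

theorem TouchesBetween.not_isVertex (hp : 2 ≤ p) {γ δ : ℚ} {i l m : ℕ}
    (h : TouchesBetween p n a γ δ i l) (him : i < m) (hml : m < l) : ¬ IsVertex p n a m := by
  intro hm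
  obtain ⟨γ', hmn, ham, hstrict⟩ := hm.exists_strictMin hp
  obtain ⟨hil, hl, hai, hal, hdi, hdl, hmin⟩ := h
  have h1 := hstrict i (by omega) hai (by omega)
  have h2 := hstrict l hl hal (by omega)
  have h3 := (hmin m hmn ham).1
  rcases le_total γ γ' with hle | hle
  · have := mul_le_mul_of_nonneg_left hle (sub_pos.mpr (pow_lt_pow_cast hp him)).le
    linarith
  · have := mul_le_mul_of_nonneg_left hle (sub_pos.mpr (pow_lt_pow_cast hp hml)).le
    linarith

theorem isVertex_zero (hp : 2 ≤ p) (ha : a 0 ≠ 0) : IsVertex p n a 0 := by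
  classical
  let f : ℕ → ℚ := fun m => ((a 0).order - (a m).order) / ((p : ℚ) ^ m - (p : ℚ) ^ 0)
  obtain ⟨γ, h, -⟩ := Order.exists_between_finsets ((Finset.range (n + 1)).image f) ∅ (by simp)
  refine StrictMin.isVertex (γ := γ) ⟨by omega, ha, fun m hm ham hm0 => ?_⟩
  have := h _ (Finset.mem_image_of_mem f (Finset.mem_range.mpr (by omega : m < n + 1)))
  rw [div_lt_iff₀ (sub_pos.mpr (pow_lt_pow_cast hp (Nat.pos_of_ne_zero hm0)))] at this
  linarith

theorem isVertex_last (hp : 2 ≤ p) (ha : a n ≠ 0) : IsVertex p n a n := by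
  classical
  let f : ℕ → ℚ := fun m => ((a m).order - (a n).order) / ((p : ℚ) ^ n - (p : ℚ) ^ m)
  obtain ⟨γ, -, h⟩ := Order.exists_between_finsets ∅ ((Finset.range (n + 1)).image f) (by simp)
  refine StrictMin.isVertex (γ := γ) ⟨le_rfl, ha, fun m hm ham hmn => ?_⟩
  have := h _ (Finset.mem_image_of_mem f (Finset.mem_range.mpr (by omega : m < n + 1)))
  rw [lt_div_iff₀ (sub_pos.mpr (pow_lt_pow_cast hp (lt_of_le_of_ne hm hmn)))] at this
  linarith

theorem IsVertex.exists_touchesBetween (hp : 2 ≤ p) (ha : a n ≠ 0) {i : ℕ}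
    (h : IsVertex p n a i) (hi : i < n) :
    ∃ γ δ l, i < l ∧ TouchesBetween p n a γ δ i l := by
  classical
  obtain ⟨γ₀, -, hai, hstrict⟩ := h.exists_strictMin hp
  let f : ℕ → ℚ := fun m => ((a i).order - (a m).order) / ((p : ℚ) ^ m - (p : ℚ) ^ i)
  obtain ⟨l, hl, hmax⟩ := Finset.exists_max_image
    ((Finset.range (n + 1)).filter fun m => a m ≠ 0 ∧ i < m) f ⟨n, by simp [ha, hi]⟩
  simp only [Finset.mem_filter, Finset.mem_range] at hl hmax
  obtain ⟨hln, hal, hil⟩ := hl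
  have hfl : f l * ((p : ℚ) ^ l - (p : ℚ) ^ i) = (a i).order - (a l).order :=
    div_mul_cancel₀ _ (sub_pos.mpr (pow_lt_pow_cast hp hil)).ne'
  have hγ : f l < γ₀ := by
    have := hstrict l (by omega) hal (by omega)
    rw [div_lt_iff₀ (sub_pos.mpr (pow_lt_pow_cast hp hil))]
    linarith
  have hlt : ∀ m < i, a m ≠ 0 →
      (a i).order + (p : ℚ) ^ i * f l < (a m).order + (p : ℚ) ^ m * f l := by
    intro m hm ham
    have h1 := hstrict m (by omega) ham (by omega)
    have h2 := mul_lt_mul_of_pos_left hγ (sub_pos.mpr (pow_lt_pow_cast hp hm))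
    linarith
  have ht : Touches p n a (f l) ((a i).order + (p : ℚ) ^ i * f l) := by
    refine ⟨fun m hm ham => ?_, i, h.1, hai, rfl⟩
    rcases lt_trichotomy m i with hmi | rfl | hmi
    · exact (hlt m hmi ham).le
    · exact le_rfl
    · have := hmax m ⟨by omega, ham, hmi⟩
      rw [div_le_iff₀ (sub_pos.mpr (pow_lt_pow_cast hp hmi))] at this
      linarith
  obtain ⟨i', l', hb⟩ := ht.exists_touchesBetween
  have hb' := hb
  obtain ⟨hil', hl', hai', -, hdi, -, hmin⟩ := hb'
  have hi' : i' = i := by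
    rcases lt_trichotomy i' i with hlt' | heq | hgt
    · exact absurd hdi (hlt i' hlt' hai').ne'
    · exact heq
    · exact absurd ((hmin i h.1 hai).2 (Or.inl hgt)) (lt_irrefl _)
  subst hi'
  refine ⟨_, _, l', ?_, hb⟩
  by_contra! hle
  have := (hmin l (by omega) hal).2 (Or.inr (by omega))
  linarith

theorem finite_isVertex (p n : ℕ) (a : ℕ → Hahn) : {i | IsVertex p n a i}.Finite :=
  (Set.finite_Iic n).subset fun _ hi => hi.1

theorem card_vertices (hp : 2 ≤ p) (ha : a 0 ≠ 0) :
    (finite_isVertex p n a).toFinset.card = numSlopes p n a + 1 := by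
  have h0 : {i | IsVertex p n a i}.ncard ≠ 0 :=
    Set.ncard_ne_zero_of_mem (a := 0) (isVertex_zero hp ha) (finite_isVertex p n a)
  rw [numSlopes, ← Set.ncard_eq_toFinset_card _ (finite_isVertex p n a)]
  omega

theorem vertexIndex_lt (hp : 2 ≤ p) (ha : a 0 ≠ 0) {i j : ℕ} (hij : i < j)
    (hj : j ≤ numSlopes p n a) : vertexIndex p n a i < vertexIndex p n a j := by
  have := card_vertices (n := n) hp ha
  exact Nat.nth_strictMonoOn (finite_isVertex p n a) (by rw [Set.mem_Iio]; omega)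
    (by rw [Set.mem_Iio]; omega) hij

theorem isVertex_vertexIndex (hp : 2 ≤ p) (ha : a 0 ≠ 0) {j : ℕ} (hj : j ≤ numSlopes p n a) :
    IsVertex p n a (vertexIndex p n a j) := by
  have := card_vertices (n := n) hp ha
  exact Nat.nth_mem_of_lt_card (finite_isVertex p n a) (by omega)

theorem IsVertex.exists_vertexIndex (hp : 2 ≤ p) (ha : a 0 ≠ 0) {i : ℕ}
    (h : IsVertex p n a i) : ∃ j ≤ numSlopes p n a, vertexIndex p n a j = i := by
  obtain ⟨j, hj, hji⟩ := Nat.exists_lt_card_finite_nth_eq (finite_isVertex p n a) h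
  rw [card_vertices hp ha] at hj
  exact ⟨j, by omega, hji⟩

theorem vertexIndex_le_iff (hp : 2 ≤ p) (ha : a 0 ≠ 0) {i j : ℕ} (hi : i ≤ numSlopes p n a)
    (hj : j ≤ numSlopes p n a) : vertexIndex p n a i ≤ vertexIndex p n a j ↔ i ≤ j := by
  rcases lt_trichotomy i j with h | rfl | h
  · simp [h.le, (vertexIndex_lt hp ha h hj).le]
  · simp
  · have := vertexIndex_lt hp ha h hi
    omega

theorem vertexIndex_zero (hp : 2 ≤ p) (ha : a 0 ≠ 0) : vertexIndex p n a 0 = 0 := by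
  rw [vertexIndex, Nat.nth_zero]
  exact Nat.le_zero.mp (Nat.sInf_le (isVertex_zero hp ha))

theorem vertexIndex_numSlopes (hp : 2 ≤ p) (ha : a 0 ≠ 0) (han : a n ≠ 0) :
    vertexIndex p n a (numSlopes p n a) = n := by
  obtain ⟨j, hj, hjn⟩ := (isVertex_last hp han).exists_vertexIndex hp ha
  refine le_antisymm (isVertex_vertexIndex hp ha le_rfl).1 ?_
  conv_lhs => rw [← hjn]
  exact (vertexIndex_le_iff hp ha hj le_rfl).mpr hj

theorem TouchesBetween.eq_neg_div (hp : 2 ≤ p) {γ δ : ℚ} {i l : ℕ}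
    (h : TouchesBetween p n a γ δ i l) (hil : i < l) :
    γ = -(((a l).order - (a i).order) / ((p : ℚ) ^ l - (p : ℚ) ^ i)) := by
  obtain ⟨-, -, -, -, hi, hl, -⟩ := h
  have := (sub_pos.mpr (pow_lt_pow_cast hp hil)).ne'
  rw [← neg_div, eq_div_iff this]
  linarith

theorem touchesBetween_slope (hp : 2 ≤ p) (ha : a 0 ≠ 0) (han : a n ≠ 0) {j : ℕ} (hj : 1 ≤ j)
    (hjk : j ≤ numSlopes p n a) :
    ∃ δ, TouchesBetween p n a (-slope p n a j) δ (vertexIndex p n a (j - 1))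
      (vertexIndex p n a j) := by
  have hlt := vertexIndex_lt hp ha (by omega : j - 1 < j) hjk
  have hjn := (isVertex_vertexIndex hp ha hjk).1
  obtain ⟨γ, δ, l, hil, hb⟩ := (isVertex_vertexIndex hp ha (by omega :
    j - 1 ≤ numSlopes p n a)).exists_touchesBetween hp han (by omega)
  obtain ⟨j', hj', rfl⟩ := (hb.isVertex_right hp).exists_vertexIndex hp ha
  have h1 : ¬ j' ≤ j - 1 := by
    rw [← vertexIndex_le_iff hp ha hj' (by omega)]
    omega
  have h2 : ¬ j < j' := fun h => hb.not_isVertex hp hlt (vertexIndex_lt hp ha h hj')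
    (isVertex_vertexIndex hp ha hjk)
  obtain rfl : j' = j := by omega
  rw [hb.eq_neg_div hp hil] at hb
  exact ⟨δ, hb⟩

theorem TouchesBetween.exists_slope (hp : 2 ≤ p) (ha : a 0 ≠ 0) {γ δ : ℚ} {i l : ℕ}
    (h : TouchesBetween p n a γ δ i l) (hil : i < l) :
    ∃ j, 1 ≤ j ∧ j ≤ numSlopes p n a ∧ γ = -slope p n a j := by
  have hγ := h.eq_neg_div hp hil
  obtain ⟨j, hj, rfl⟩ := (h.isVertex_left hp).exists_vertexIndex hp ha
  obtain ⟨j', hj', rfl⟩ := (h.isVertex_right hp).exists_vertexIndex hp ha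
  have h1 : ¬ j' ≤ j := by
    rw [← vertexIndex_le_iff hp ha hj' hj]
    omega
  have h2 : ¬ j + 1 < j' := fun h' => h.not_isVertex hp
    (vertexIndex_lt hp ha (by omega : j < j + 1) (by omega)) (vertexIndex_lt hp ha h' hj')
    (isVertex_vertexIndex hp ha (by omega))
  obtain rfl : j' = j + 1 := by omega
  exact ⟨j + 1, by omega, hj', by rw [hγ, slope, Nat.add_sub_cancel]⟩

theorem slope_lt (hp : 2 ≤ p) (ha : a 0 ≠ 0) (han : a n ≠ 0) {i j : ℕ} (hi : 1 ≤ i)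
    (hij : i < j) (hj : j ≤ numSlopes p n a) : slope p n a i < slope p n a j := by
  obtain ⟨δ, -, -, -, hai, -, hdi, hmin⟩ :=
    touchesBetween_slope hp ha han hi (by omega : i ≤ numSlopes p n a)
  obtain ⟨δ', -, hln, -, hal, -, hdl, hmin'⟩ :=
    touchesBetween_slope hp ha han (by omega : 1 ≤ j) hj
  have hlt := vertexIndex_lt hp ha hij hj
  have h1 := (hmin _ hln hal).2 (Or.inr hlt)
  have h2 := (hmin' _ (isVertex_vertexIndex hp ha (by omega)).1 hai).1
  have hpos := sub_pos.mpr (pow_lt_pow_cast hp hlt)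
  refine lt_of_mul_lt_mul_left ?_ hpos.le
  linarith

theorem sum_slopeMult (hp : 2 ≤ p) (ha : a 0 ≠ 0) {j : ℕ} (hj : j ≤ numSlopes p n a) :
    ∑ l ∈ Finset.Ico 1 (j + 1), slopeMult p n a l = vertexIndex p n a j := by
  induction j with
  | zero => simp [vertexIndex_zero hp ha]
  | succ j ih =>
    rw [Finset.sum_Ico_succ_top (by omega), ih (by omega), slopeMult, Nat.add_sub_cancel]
    have := vertexIndex_lt hp ha (by omega : j < j + 1) hj
    omega

theorem touches_slope (hp : 2 ≤ p) (ha : a 0 ≠ 0) (han : a n ≠ 0) {j : ℕ} (hj : 1 ≤ j)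
    (hjk : j ≤ numSlopes p n a) :
    TouchesBetween p n a (-slope p n a j) ((a 0).order - nu p n a j / ((p : ℚ) - 1))
      (vertexIndex p n a (j - 1)) (vertexIndex p n a j) := by
  have hp1 : (p : ℚ) - 1 ≠ 0 := by
    have : (2 : ℚ) ≤ p := by exact_mod_cast hp
    linarith
  rw [nu, mul_div_cancel_left₀ _ hp1]
  induction j, hj using Nat.le_induction with
  | base =>
    obtain ⟨δ, h⟩ := touchesBetween_slope hp ha han le_rfl hjk
    have h' := h.2.2.2.2.1
    rw [Nat.sub_self, vertexIndex_zero hp ha] at h'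
    convert h using 1
    rw [← h']
    simp
    ring
  | succ j hj ih =>
    obtain ⟨δ, h⟩ := touchesBetween_slope hp ha han (by omega : 1 ≤ j + 1) hjk
    have h1 := (ih (by omega)).2.2.2.2.2.1
    have h2 := h.2.2.2.2.1
    rw [Nat.add_sub_cancel] at h2
    convert h using 1
    rw [Finset.sum_Icc_succ_top (by omega), Nat.add_sub_cancel]
    obtain ⟨i, rfl⟩ : ∃ i, j = i + 1 := ⟨j - 1, by omega⟩
    rw [sum_slopeMult hp ha (by omega)]
    linarith

end Newton

/-! ## Characteristic polynomials -/

/-- If `δ` is the minimum of `val (a_i) + p ^ i * γ`, the polynomial whose coefficient of index `i`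
is the coefficient of `z ^ δ` in `a_i z ^ (p ^ i * γ)`. -/
def charAt (p n : ℕ) (a : ℕ → Hahn) (γ δ : ℚ) : Polynomial ℂ :=
  ∑ i ∈ Finset.range (n + 1), Polynomial.monomial i ((a i).coeff (δ - (p : ℚ) ^ i * γ))

section CharAt

variable {p n : ℕ} {a : ℕ → Hahn}

theorem coeff_charAt (γ δ : ℚ) (i : ℕ) :
    (charAt p n a γ δ).coeff i = if i ≤ n then (a i).coeff (δ - (p : ℚ) ^ i * γ) else 0 := by
  simp only [charAt, Polynomial.finsetSum_coeff, Polynomial.coeff_monomial, Finset.sum_ite_eq',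
    Finset.mem_range, Nat.lt_succ_iff]

theorem TouchesBetween.coeff_charAt_eq_zero {γ δ : ℚ} {i l m : ℕ}
    (h : TouchesBetween p n a γ δ i l) (hm : m < i ∨ l < m) :
    (charAt p n a γ δ).coeff m = 0 := by
  rw [coeff_charAt]
  split_ifs with hmn
  · by_cases ham : a m = 0
    · simp [ham]
    · have := (h.2.2.2.2.2.2 m hmn ham).2 hm
      exact HahnSeries.coeff_eq_zero_of_lt_order (by linarith)
  · rfl

theorem TouchesBetween.coeff_charAt_left {γ δ : ℚ} {i l : ℕ}
    (h : TouchesBetween p n a γ δ i l) : (charAt p n a γ δ).coeff i ≠ 0 := by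
  rw [coeff_charAt, if_pos (h.1.trans h.2.1), ← h.2.2.2.2.1, add_sub_cancel_right]
  exact mt HahnSeries.coeff_order_eq_zero.mp h.2.2.1

theorem TouchesBetween.coeff_charAt_right {γ δ : ℚ} {i l : ℕ}
    (h : TouchesBetween p n a γ δ i l) : (charAt p n a γ δ).coeff l ≠ 0 := by
  rw [coeff_charAt, if_pos h.2.1, ← h.2.2.2.2.2.1, add_sub_cancel_right]
  exact mt HahnSeries.coeff_order_eq_zero.mp h.2.2.2.1

theorem TouchesBetween.charAt_ne_zero {γ δ : ℚ} {i l : ℕ}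
    (h : TouchesBetween p n a γ δ i l) : charAt p n a γ δ ≠ 0 := by
  intro h0
  exact h.coeff_charAt_left (by rw [h0, Polynomial.coeff_zero])

theorem Touches.charAt_ne_zero {γ δ : ℚ} (h : Touches p n a γ δ) : charAt p n a γ δ ≠ 0 := by
  obtain ⟨i, l, h⟩ := h.exists_touchesBetween
  exact h.charAt_ne_zero

theorem TouchesBetween.natDegree_charAt {γ δ : ℚ} {i l : ℕ}
    (h : TouchesBetween p n a γ δ i l) : (charAt p n a γ δ).natDegree = l :=
  Polynomial.natDegree_eq_of_le_of_coeff_ne_zero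
    (Polynomial.natDegree_le_iff_coeff_eq_zero.mpr fun _ hm => h.coeff_charAt_eq_zero (Or.inr hm))
    h.coeff_charAt_right

theorem TouchesBetween.natTrailingDegree_charAt {γ δ : ℚ} {i l : ℕ}
    (h : TouchesBetween p n a γ δ i l) : (charAt p n a γ δ).natTrailingDegree = i :=
  le_antisymm (Polynomial.natTrailingDegree_le_of_ne_zero h.coeff_charAt_left)
    (Polynomial.le_natTrailingDegree h.charAt_ne_zero
      fun _ hm => h.coeff_charAt_eq_zero (Or.inl hm))

theorem gauge_slope (hp : 2 ≤ p) (μ : ℚ) (i : ℕ) :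
    gauge p a (-(((p : ℚ) - 1) * μ)) i = zPow ℂ (-(((p : ℚ) ^ i - 1) * μ)) * a i := by
  have hp1 : (p : ℚ) - 1 ≠ 0 := by
    have : (2 : ℚ) ≤ p := by exact_mod_cast hp
    linarith
  rw [gauge]
  congr 2
  field_simp

theorem opVal_gauge (hp : 2 ≤ p) {μ δ : ℚ} (h : Touches p n a (-μ) δ) :
    opVal n (gauge p a (-(((p : ℚ) - 1) * μ))) = δ + μ := by
  have key : ∀ i, a i ≠ 0 → (gauge p a (-(((p : ℚ) - 1) * μ)) i).orderTop =
      (((a i).order + (p : ℚ) ^ i * -μ + μ : ℚ) : WithTop ℚ) := by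
    intro i hai
    rw [gauge_slope hp, HahnSeries.orderTop_mul, ← HahnSeries.order_eq_orderTop_of_ne_zero hai,
      zPow, HahnSeries.orderTop_single one_ne_zero, ← WithTop.coe_add]
    congr 1
    ring
  have : ((Finset.range (n + 1)).inf
      fun i => (gauge p a (-(((p : ℚ) - 1) * μ)) i).orderTop) = ((δ + μ : ℚ) : WithTop ℚ) := by
    apply le_antisymm
    · obtain ⟨i, hi, hai, rfl⟩ := h.2
      exact (Finset.inf_le (Finset.mem_range.mpr (by omega : i < n + 1))).trans (key i hai).le
    · refine Finset.le_inf fun i hi => ?_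
      by_cases hai : a i = 0
      · simp [gauge, hai]
      · rw [key i hai, WithTop.coe_le_coe]
        have := h.1 i (Nat.lt_succ_iff.mp (Finset.mem_range.mp hi)) hai
        linarith
  rw [opVal, this]
  rfl

theorem charPoly_eq_charAt (hp : 2 ≤ p) {j : ℕ} {δ : ℚ}
    (h : Touches p n a (-slope p n a j) δ) :
    charPoly p n a j = charAt p n a (-slope p n a j) δ := by
  simp only [charPoly, charAt]
  rw [opVal_gauge hp h]
  refine Finset.sum_congr rfl fun i _ => ?_
  rw [gauge_slope hp, zPow, zPow, HahnSeries.coeff_single_mul, HahnSeries.coeff_single_mul,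
    one_mul, one_mul]
  congr 2
  ring

theorem rootMultiplicity_charAt (hp : 2 ≤ p) (ha : a 0 ≠ 0) {γ δ : ℚ}
    (h : Touches p n a γ δ) (c : ℂˣ)
    (hc : (charAt p n a γ δ).rootMultiplicity (c : ℂ) ≠ 0) :
    ∃ j, 1 ≤ j ∧ j ≤ numSlopes p n a ∧ γ = -slope p n a j ∧
      (charAt p n a γ δ).rootMultiplicity (c : ℂ) = expMult p n a c j := by
  obtain ⟨i, l, hb⟩ := h.exists_touchesBetween
  rcases hb.1.eq_or_lt with rfl | hil
  · exfalso
    have hroot := (Polynomial.rootMultiplicity_pos hb.charAt_ne_zero).mp (Nat.pos_of_ne_zero hc)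
    have hmon : charAt p n a γ δ = Polynomial.monomial i ((charAt p n a γ δ).coeff i) := by
      ext m
      rw [Polynomial.coeff_monomial]
      split_ifs with him
      · rw [him]
      · exact hb.coeff_charAt_eq_zero (by omega)
    rw [hmon, Polynomial.IsRoot, Polynomial.eval_monomial] at hroot
    exact mul_ne_zero hb.coeff_charAt_left (pow_ne_zero _ c.ne_zero) hroot
  · obtain ⟨j, hj, hjk, rfl⟩ := hb.exists_slope hp ha hil
    exact ⟨j, hj, hjk, rfl, by rw [expMult, charPoly_eq_charAt hp h]⟩

theorem sum_rootMultiplicity_ne_zero (f : Polynomial ℂ) :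
    ∑ c ∈ f.roots.toFinset.erase 0, f.rootMultiplicity c =
      f.natDegree - f.natTrailingDegree := by
  classical
  have h1 : ∑ c ∈ f.roots.toFinset, f.rootMultiplicity c = f.natDegree := by
    rw [← IsAlgClosed.card_roots_eq_natDegree, ← Multiset.toFinset_sum_count_eq]
    exact Finset.sum_congr rfl fun c _ => (Polynomial.count_roots f).symm
  have h2 : ∑ c ∈ f.roots.toFinset.erase 0, f.rootMultiplicity c + f.rootMultiplicity 0 =
      f.natDegree := by
    rw [← h1]
    by_cases h0 : 0 ∈ f.roots.toFinset
    · exact Finset.sum_erase_add _ _ h0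
    · rw [Finset.erase_eq_of_notMem h0, ← Polynomial.count_roots, Multiset.count_eq_zero_of_notMem
        (fun h => h0 (Multiset.mem_toFinset.mpr h)), add_zero]
  rw [← Polynomial.rootMultiplicity_eq_natTrailingDegree']
  omega

theorem charPoly_ne_zero (hp : 2 ≤ p) (ha : a 0 ≠ 0) (han : a n ≠ 0) {j : ℕ} (hj : 1 ≤ j)
    (hjk : j ≤ numSlopes p n a) : charPoly p n a j ≠ 0 := by
  have h := touches_slope hp ha han hj hjk
  rw [charPoly_eq_charAt hp h.touches]
  exact h.charAt_ne_zero

theorem encard_frobeniusIndex (hp : 2 ≤ p) (ha : a 0 ≠ 0) (han : a n ≠ 0) :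
    (frobeniusIndex p n a).encard = n := by
  classical
  let F : ℂˣ × ℕ × ℕ → (_ : ℕ) × (_ : ℂ) × ℕ := fun t => ⟨t.2.1, (t.1 : ℂ), t.2.2⟩
  have hF : Function.Injective F := by
    rintro ⟨c, j, m⟩ ⟨c', j', m'⟩ h
    simp only [F, Sigma.mk.injEq, heq_eq_eq] at h
    obtain ⟨rfl, hc, rfl⟩ := h
    rw [Units.ext hc]
  let S : Finset ((_ : ℕ) × (_ : ℂ) × ℕ) := (Finset.Icc 1 (numSlopes p n a)).sigma fun j =>
    ((charPoly p n a j).roots.toFinset.erase 0).sigma fun c =>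
      Finset.range ((charPoly p n a j).rootMultiplicity c)
  have hS : F '' frobeniusIndex p n a = (S : Set _) := by
    ext ⟨j, c, m⟩
    simp only [Set.mem_image, Finset.mem_coe, S, Finset.mem_sigma, Finset.mem_Icc,
      Finset.mem_erase, Multiset.mem_toFinset, Finset.mem_range]
    constructor
    · rintro ⟨⟨c', j', m'⟩, ⟨h1, h2, h3, h4⟩, h⟩
      simp only [F, Sigma.mk.injEq, heq_eq_eq] at h
      obtain ⟨rfl, rfl, rfl⟩ := h
      exact ⟨⟨h1, h2⟩, ⟨c'.ne_zero,
        (Polynomial.mem_roots (charPoly_ne_zero hp ha han h1 h2)).mpr h3⟩, h4⟩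
    · rintro ⟨⟨h1, h2⟩, ⟨h3, h4⟩, h5⟩
      exact ⟨⟨Units.mk0 c h3, j, m⟩, ⟨h1, h2, (Polynomial.mem_roots'.mp h4).2, h5⟩, rfl⟩
  rw [← hF.encard_image, hS, Set.encard_coe_eq_coe_finsetCard]
  congr 1
  simp only [S, Finset.card_sigma, Finset.card_range, sum_rootMultiplicity_ne_zero]
  have h1 : ∀ j ∈ Finset.Icc 1 (numSlopes p n a),
      (charPoly p n a j).natDegree - (charPoly p n a j).natTrailingDegree =
        slopeMult p n a j := by
    intro j hj
    rw [Finset.mem_Icc] at hj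
    have h := touches_slope hp ha han hj.1 hj.2
    rw [charPoly_eq_charAt hp h.touches, h.natDegree_charAt, h.natTrailingDegree_charAt, slopeMult]
  rw [Finset.sum_congr rfl h1, ← Finset.Ico_add_one_right_eq_Icc, sum_slopeMult hp ha le_rfl,
    vertexIndex_numSlopes hp ha han]

end CharAt

/-! ## The twisted Mahler operator on Hahn series -/

section Coeff

variable {A : Type*} [CommRing A]

theorem coeff_mahlerHahn {p : ℕ} (hp : 2 ≤ p) (f : HahnSeries ℚ A) (γ : ℚ) :
    (mahlerHahn p hp A f).coeff γ = f.coeff (γ / p) := by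
  have hp0 : (p : ℚ) ≠ 0 := by positivity
  conv_lhs => rw [← mul_div_cancel₀ γ hp0]
  exact HahnSeries.embDomain_coeff

theorem coeff_mahlerHahn_iterate {p : ℕ} (hp : 2 ≤ p) (i : ℕ) (f : HahnSeries ℚ A) (γ : ℚ) :
    ((mahlerHahn p hp A)^[i] f).coeff γ = f.coeff (γ / (p : ℚ) ^ i) := by
  induction i generalizing γ with
  | zero => simp
  | succ i ih =>
    rw [Function.iterate_succ_apply', coeff_mahlerHahn, ih, div_div, pow_succ']

theorem coeff_hahnMap {B : Type*} [CommRing B] (f : A →+* B) (x : HahnSeries ℚ A) (γ : ℚ) :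
    (hahnMap f x).coeff γ = f (x.coeff γ) := rfl

theorem coeff_mul_of_bounds {x y : HahnSeries ℚ A} {α β : ℚ} (hx : ∀ α' < α, x.coeff α' = 0)
    (hy : ∀ β' < β, y.coeff β' = 0) : (x * y).coeff (α + β) = x.coeff α * y.coeff β := by
  rw [HahnSeries.coeff_mul]
  refine Finset.sum_eq_single (α, β) (fun ij hij hne => ?_) (fun hmem => ?_)
  · obtain ⟨-, -, h⟩ := Finset.mem_antidiagonal.mp hij
    rcases lt_trichotomy ij.1 α with h1 | h1 | h1
    · rw [hx _ h1, zero_mul]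
    · exact absurd (Prod.ext h1 (by dsimp only; linarith)) hne
    · rw [hy ij.2 (by linarith), mul_zero]
  · by_contra hne
    exact hmem (Finset.mem_antidiagonal.mpr
      ⟨left_ne_zero_of_mul hne, right_ne_zero_of_mul hne, rfl⟩)

theorem coeff_mul_eq_zero_of_bounds {x y : HahnSeries ℚ A} {α β δ : ℚ}
    (hx : ∀ α' < α, x.coeff α' = 0) (hy : ∀ β' < β, y.coeff β' = 0) (hδ : δ < α + β) :
    (x * y).coeff δ = 0 := by
  rw [← sub_add_cancel δ β, coeff_mul_of_bounds (fun α' h => hx α' (by linarith)) hy,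
    hx _ (by linarith), zero_mul]

end Coeff

section TwistedOp

variable {A : Type*} [CommRing A]

/-- The operator `g ↦ ∑ a_i l ^ i φ ^ i (g)` on Hahn series with coefficients in `A`, where `l` is
an element of `A` and the coefficients of the `a_i` are sent to `A` by `ι`. -/
def twistedOp (p : ℕ) (hp : 2 ≤ p) (n : ℕ) (a : ℕ → Hahn) (ι : ℂ →+* A) (l : A) :
    HahnSeries ℚ A →+ HahnSeries ℚ A where
  toFun g := ∑ i ∈ Finset.range (n + 1),
    hahnMap ι (a i) * HahnSeries.C (l ^ i) * (mahlerHahn p hp A)^[i] g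
  map_zero' := by simp
  map_add' f g := by simp [mul_add, Finset.sum_add_distrib, iterate_map_add]

variable {p : ℕ} (hp : 2 ≤ p) {n : ℕ} {a : ℕ → Hahn} (ι : ℂ →+* A) (l : A)

theorem coeff_twistedOp (g : HahnSeries ℚ A) (δ : ℚ) :
    (twistedOp p hp n a ι l g).coeff δ = ∑ i ∈ Finset.range (n + 1),
      (hahnMap ι (a i) * (l ^ i • (mahlerHahn p hp A)^[i] g)).coeff δ := by
  change (∑ i ∈ Finset.range (n + 1), _ : HahnSeries ℚ A).coeff δ = _
  rw [HahnSeries.coeff_sum]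
  simp only [mul_assoc, HahnSeries.C_mul_eq_smul]

theorem coeff_smul_mahlerHahn_iterate_eq_zero {g : HahnSeries ℚ A} {γ : ℚ}
    (hg : ∀ γ' < γ, g.coeff γ' = 0) (i : ℕ) :
    ∀ β' < (p : ℚ) ^ i * γ, (l ^ i • (mahlerHahn p hp A)^[i] g).coeff β' = 0 := by
  intro β' h
  rw [HahnSeries.coeff_smul, coeff_mahlerHahn_iterate, hg _ ?_, smul_zero]
  rwa [div_lt_iff₀' (pow_pos_cast hp i)]

variable {γ δ : ℚ}

theorem Touches.coeff_hahnMap_eq_zero (h : Touches p n a γ δ) {i : ℕ} (hi : i ≤ n) :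
    ∀ α' < δ - (p : ℚ) ^ i * γ, (hahnMap ι (a i)).coeff α' = 0 := by
  intro α' hα'
  rw [coeff_hahnMap]
  by_cases hai : a i = 0
  · simp [hai]
  · have := h.1 i hi hai
    rw [HahnSeries.coeff_eq_zero_of_lt_order (by linarith), map_zero]

theorem Touches.coeff_twistedOp_eq_zero (h : Touches p n a γ δ) {g : HahnSeries ℚ A}
    (hg : ∀ γ' < γ, g.coeff γ' = 0) {δ' : ℚ} (hδ : δ' < δ) :
    (twistedOp p hp n a ι l g).coeff δ' = 0 := by
  rw [coeff_twistedOp]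
  refine Finset.sum_eq_zero fun i hi => ?_
  exact coeff_mul_eq_zero_of_bounds
    (h.coeff_hahnMap_eq_zero ι (Nat.lt_succ_iff.mp (Finset.mem_range.mp hi)))
    (coeff_smul_mahlerHahn_iterate_eq_zero hp l hg i) (by rwa [sub_add_cancel])

theorem Touches.coeff_twistedOp (h : Touches p n a γ δ) {g : HahnSeries ℚ A}
    (hg : ∀ γ' < γ, g.coeff γ' = 0) :
    (twistedOp p hp n a ι l g).coeff δ = (charAt p n a γ δ).eval₂ ι l * g.coeff γ := by
  rw [MahlerFrobenius.coeff_twistedOp, charAt, Polynomial.eval₂_finsetSum, Finset.sum_mul]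
  refine Finset.sum_congr rfl fun i hi => ?_
  have := coeff_mul_of_bounds
    (h.coeff_hahnMap_eq_zero ι (Nat.lt_succ_iff.mp (Finset.mem_range.mp hi)))
    (coeff_smul_mahlerHahn_iterate_eq_zero hp l hg i)
  rw [sub_add_cancel] at this
  rw [this, HahnSeries.coeff_smul, coeff_mahlerHahn_iterate, mul_div_cancel_left₀ _
    (pow_pos_cast hp i).ne', Polynomial.eval₂_monomial, coeff_hahnMap, smul_eq_mul, mul_assoc]

theorem coeff_twistedOp_mem (V : AddSubgroup A)
    (hV : ∀ (x : ℂ) (i : ℕ), ∀ f ∈ V, ι x * l ^ i * f ∈ V)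
    {g : HahnSeries ℚ A} (hg : ∀ γ, g.coeff γ ∈ V) (δ : ℚ) :
    (twistedOp p hp n a ι l g).coeff δ ∈ V := by
  rw [MahlerFrobenius.coeff_twistedOp]
  refine sum_mem fun i _ => ?_
  rw [HahnSeries.coeff_mul]
  refine sum_mem fun ij _ => ?_
  rw [HahnSeries.coeff_smul, coeff_mahlerHahn_iterate, smul_eq_mul, ← mul_assoc, coeff_hahnMap]
  exact hV _ _ _ (hg _)

end TwistedOp

section Solve

variable {K : Type*} [Field K] {p : ℕ} (hp : 2 ≤ p) {n : ℕ} {a : ℕ → Hahn} (ι : ℂ →+* K) (l : K)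

theorem twistedOp_injective (ha : a 0 ≠ 0)
    (hl : ∀ f : Polynomial ℂ, f ≠ 0 → f.eval₂ ι l ≠ 0) :
    Function.Injective (twistedOp p hp n a ι l) := by
  rw [injective_iff_map_eq_zero]
  intro g hg
  by_contra hne
  obtain ⟨δ, h⟩ := exists_touches_right (p := p) (n := n) ha g.order
  have := h.coeff_twistedOp hp ι l (g := g) fun _ => HahnSeries.coeff_eq_zero_of_lt_order
  rw [hg, HahnSeries.coeff_zero] at this
  exact mul_ne_zero (hl _ h.charAt_ne_zero) (mt HahnSeries.coeff_order_eq_zero.mp hne) this.symm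

theorem order_of_twistedOp_eq_single (ha : a 0 ≠ 0)
    (hl : ∀ f : Polynomial ℂ, f ≠ 0 → f.eval₂ ι l ≠ 0) {γ δ : ℚ} (h : Touches p n a γ δ)
    {g : HahnSeries ℚ K} {u : K} (hu : u ≠ 0)
    (hg : twistedOp p hp n a ι l g = HahnSeries.single δ u) :
    g.orderTop = γ ∧ (charAt p n a γ δ).eval₂ ι l * g.coeff γ = u := by
  have hg0 : g ≠ 0 := by
    rintro rfl
    rw [map_zero] at hg
    exact hu (HahnSeries.single_eq_zero_iff.mp hg.symm)
  obtain ⟨δ', h'⟩ := exists_touches_right (p := p) (n := n) ha g.order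
  have hδ' := h'.coeff_twistedOp hp ι l (g := g) fun _ => HahnSeries.coeff_eq_zero_of_lt_order
  have hne := mul_ne_zero (hl _ h'.charAt_ne_zero) (mt HahnSeries.coeff_order_eq_zero.mp hg0)
  rw [hg] at hδ'
  obtain rfl : δ' = δ := by
    by_contra hne'
    rw [HahnSeries.coeff_single_of_ne hne'] at hδ'
    exact hne hδ'.symm
  obtain rfl : g.order = γ := by
    rcases lt_trichotomy g.order γ with hlt | heq | hlt
    · exact absurd (h'.lt_of_lt hp h hlt) (lt_irrefl _)
    · exact heq
    · exact absurd (h.lt_of_lt hp h' hlt) (lt_irrefl _)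
  refine ⟨(HahnSeries.order_eq_orderTop_of_ne_zero hg0).symm, ?_⟩
  rw [← hδ', HahnSeries.coeff_single_same]

/-- The Hahn series `g` agrees with `f` up to every element of the support of `f`. -/
def IsContinuation {A : Type*} [Zero A] (f g : HahnSeries ℚ A) : Prop :=
  ∀ γ, f.coeff γ ≠ 0 → ∀ γ' ≤ γ, g.coeff γ' = f.coeff γ'

theorem IsContinuation.trans {A : Type*} [Zero A] {f g h : HahnSeries ℚ A}
    (hfg : IsContinuation f g) (hgh : IsContinuation g h) : IsContinuation f h := by
  intro γ hγ γ' hγ'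
  rw [hgh γ (by rwa [hfg γ hγ γ le_rfl]) γ' hγ', hfg γ hγ γ' hγ']

theorem exists_isContinuation_of_isChain {A : Type*} [Zero A] {s : Set (HahnSeries ℚ A)}
    (hs : ∀ f ∈ s, ∀ g ∈ s, IsContinuation f g ∨ IsContinuation g f) :
    ∃ u : HahnSeries ℚ A, (∀ f ∈ s, IsContinuation f u) ∧
      ∀ γ, u.coeff γ ≠ 0 → ∃ f ∈ s, f.coeff γ ≠ 0 := by
  classical
  let w : ℚ → A := fun γ => if h : ∃ f ∈ s, f.coeff γ ≠ 0 then h.choose.coeff γ else 0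
  have hw : ∀ γ, w γ ≠ 0 → ∃ f ∈ s, f.coeff γ ≠ 0 := by
    intro γ hγ
    by_contra h
    exact hγ (dif_neg h)
  have hws : ∀ f ∈ s, ∀ γ, f.coeff γ ≠ 0 → ∀ γ' ≤ γ, w γ' = f.coeff γ' := by
    intro f hf γ hγ γ' hγ'
    by_cases h : ∃ f ∈ s, f.coeff γ' ≠ 0
    · have hwγ : w γ' = h.choose.coeff γ' := dif_pos h
      rw [hwγ]
      rcases hs f hf _ h.choose_spec.1 with hc | hc
      · exact hc γ hγ γ' hγ'
      · exact (hc γ' h.choose_spec.2 γ' le_rfl).symm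
    · rw [show w γ' = 0 from dif_neg h]
      by_contra hne
      exact h ⟨f, hf, fun h0 => hne h0.symm⟩
  have hpwo : (Function.support w).IsPWO := by
    rw [Set.isPWO_iff_isWF, Set.isWF_iff_no_descending_seq]
    intro e he hmem
    obtain ⟨f, hf, hf0⟩ := hw _ (hmem 0)
    refine (Set.isWF_iff_no_descending_seq.mp f.isWF_support) e he fun m => ?_
    rw [HahnSeries.mem_support, ← hws f hf _ hf0 _ (he.antitone (Nat.zero_le m))]
    exact hmem m
  exact ⟨⟨w, hpwo⟩, hws, hw⟩

/-- The equation `M g = h` for the twisted Mahler operator `M` has a solution, whose coefficients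
lie in prescribed groups. -/
theorem exists_twistedOp_eq (ha : a 0 ≠ 0)
    (hl : ∀ f : Polynomial ℂ, f ≠ 0 → f.eval₂ ι l ≠ 0) (h : HahnSeries ℚ K)
    (E E' : ℚ → AddSubgroup K)
    (hmul : ∀ γ (x : ℂ) (i : ℕ), ∀ f ∈ E' γ, ι x * l ^ i * f ∈ E' γ)
    (hle : ∀ γ γ', γ' < γ → E γ' ≤ E' γ)
    (hdiv : ∀ γ δ, Touches p n a γ δ → ∀ f ∈ E' γ, f / (charAt p n a γ δ).eval₂ ι l ∈ E γ)
    (hh : ∀ γ δ, Touches p n a γ δ → h.coeff δ ∈ E' γ) :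
    ∃ g, twistedOp p hp n a ι l g = h ∧ ∀ γ, g.coeff γ ∈ E γ := by
  classical
  let P : Type _ := {g : HahnSeries ℚ K // (∀ γ, g.coeff γ ∈ E γ) ∧ ∀ γ, g.coeff γ ≠ 0 →
    ∀ δ, Touches p n a γ δ → ∀ δ' ≤ δ, (twistedOp p hp n a ι l g).coeff δ' = h.coeff δ'}
  obtain ⟨⟨g, hgE, hgF⟩, hmax⟩ := exists_maximal_of_chains_bounded
    (α := P) (r := fun f g => IsContinuation f.1 g.1) (by
      intro c hc
      obtain ⟨u, hu, hu'⟩ := exists_isContinuation_of_isChain (s := Subtype.val '' c) (by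
        rintro _ ⟨f, hf, rfl⟩ _ ⟨g, hg, rfl⟩
        by_cases hfg : f = g
        · subst hfg
          exact Or.inl fun _ _ _ _ => rfl
        · exact hc hf hg hfg)
      refine ⟨⟨u, fun γ => ?_, fun γ hγ δ ht δ' hδ' => ?_⟩, fun f hf => hu _ ⟨f, hf, rfl⟩⟩
      · by_cases hγ : u.coeff γ = 0
        · rw [hγ]
          exact zero_mem _
        · obtain ⟨_, ⟨f, hf, rfl⟩, hfγ⟩ := hu' γ hγ
          rw [hu _ ⟨f, hf, rfl⟩ γ hfγ γ le_rfl]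
          exact f.2.1 γ
      · obtain ⟨_, ⟨f, hf, rfl⟩, hfγ⟩ := hu' γ hγ
        rw [← f.2.2 γ hfγ δ ht δ' hδ', ← sub_eq_zero, ← HahnSeries.coeff_sub, ← map_sub]
        have hz : ∀ γ' ≤ γ, (u - f.1).coeff γ' = 0 := fun γ' hγ' => by
          rw [HahnSeries.coeff_sub, hu _ ⟨f, hf, rfl⟩ γ hfγ γ' hγ', sub_self]
        rcases hδ'.eq_or_lt with rfl | hlt
        · rw [ht.coeff_twistedOp hp ι l fun γ' hγ' => hz γ' hγ'.le, hz γ le_rfl, mul_zero]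
        · exact ht.coeff_twistedOp_eq_zero hp ι l (fun γ' hγ' => hz γ' hγ'.le) hlt)
    (fun h1 h2 => h1.trans h2)
  refine ⟨g, ?_, hgE⟩
  by_contra hne
  set r := h - twistedOp p hp n a ι l g with hr
  have hr0 : r ≠ 0 := sub_ne_zero.mpr (Ne.symm hne)
  obtain ⟨γ₀, ht⟩ := exists_touches_left (n := n) hp ha r.order
  set χ := (charAt p n a γ₀ r.order).eval₂ ι l with hχ
  have hχ0 : χ ≠ 0 := hl _ ht.charAt_ne_zero
  have hlt : ∀ γ, g.coeff γ ≠ 0 → γ < γ₀ := by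
    intro γ hγ
    by_contra! hge
    obtain ⟨δ, hδ⟩ := exists_touches_right (p := p) (n := n) ha γ
    have := hgF γ hγ δ hδ r.order (ht.le_of_le hp hδ hge)
    refine mt HahnSeries.coeff_order_eq_zero.mp hr0 ?_
    rw [hr, HahnSeries.coeff_sub, this, sub_self]
  have hg0 : ∀ γ, γ₀ ≤ γ → g.coeff γ = 0 := by
    intro γ hγ
    by_contra hne
    exact absurd (hlt γ hne) hγ.not_gt
  have hrE : r.coeff r.order ∈ E' γ₀ := by
    rw [hr, HahnSeries.coeff_sub]
    refine sub_mem (hh γ₀ _ ht) (coeff_twistedOp_mem hp ι l _ (hmul γ₀) (fun γ => ?_) _)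
    by_cases hγ : g.coeff γ = 0
    · rw [hγ]
      exact zero_mem _
    · exact hle _ _ (hlt γ hγ) (hgE γ)
  set g' := g + HahnSeries.single γ₀ (r.coeff r.order / χ) with hg'
  have hg'γ : ∀ γ, γ ≠ γ₀ → g'.coeff γ = g.coeff γ := by
    intro γ hγ
    rw [hg', HahnSeries.coeff_add, HahnSeries.coeff_single_of_ne hγ, add_zero]
  have hg'γ₀ : g'.coeff γ₀ = r.coeff r.order / χ := by
    rw [hg', HahnSeries.coeff_add, HahnSeries.coeff_single_same, hg0 _ le_rfl, zero_add]
  have hg'F : ∀ δ' ≤ r.order, (twistedOp p hp n a ι l g').coeff δ' = h.coeff δ' := by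
    intro δ' hδ'
    have hs : ∀ γ' < γ₀, (HahnSeries.single γ₀ (r.coeff r.order / χ)).coeff γ' = 0 :=
      fun γ' hγ' => HahnSeries.coeff_single_of_ne hγ'.ne
    have hrδ : h.coeff δ' = (twistedOp p hp n a ι l g).coeff δ' + r.coeff δ' := by
      rw [hr, HahnSeries.coeff_sub, add_sub_cancel]
    rw [hg', map_add, HahnSeries.coeff_add, hrδ]
    congr 1
    rcases hδ'.eq_or_lt with rfl | hlt
    · rw [ht.coeff_twistedOp hp ι l hs, HahnSeries.coeff_single_same, mul_div_cancel₀ _ hχ0]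
    · rw [ht.coeff_twistedOp_eq_zero hp ι l hs hlt, HahnSeries.coeff_eq_zero_of_lt_order hlt]
  have hg'lt : ∀ γ, g'.coeff γ ≠ 0 → γ ≤ γ₀ := by
    intro γ hγ
    by_contra! hgt
    rw [hg'γ γ hgt.ne', hg0 γ hgt.le] at hγ
    exact hγ rfl
  have hcont := hmax ⟨g', fun γ => ?_, fun γ hγ δ hδ δ' hδ' =>
    hg'F δ' (hδ'.trans (hδ.le_of_le hp ht (hg'lt γ hγ)))⟩ fun γ hγ γ' hγ' =>
      hg'γ γ' (hγ'.trans_lt (hlt γ hγ)).ne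
  · have hne₀ : g'.coeff γ₀ ≠ 0 := by
      rw [hg'γ₀]
      exact div_ne_zero (mt HahnSeries.coeff_order_eq_zero.mp hr0) hχ0
    exact hne₀ ((hcont γ₀ hne₀ γ₀ le_rfl).symm.trans (hg0 γ₀ le_rfl))
  · by_cases hγ : γ = γ₀
    · rw [hγ, hg'γ₀]
      exact hdiv _ _ ht _ hrE
    · rw [hg'γ γ hγ]
      exact hgE γ

end Solve

/-! ## Rational functions vanishing to a given order -/

section Vanishing

theorem algebraMap_div_mem_regularAt {c : ℂ} (f : Polynomial ℂ) {q : Polynomial ℂ}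
    (hq : q.eval c ≠ 0) :
    algebraMap (Polynomial ℂ) (RatFunc ℂ) f / algebraMap (Polynomial ℂ) (RatFunc ℂ) q ∈
      regularAt c :=
  fun h => hq (Polynomial.eval_eq_zero_of_dvd_of_eval_eq_zero (RatFunc.denom_div_dvd f q) h)

theorem algebraMap_mem_regularAt (c : ℂ) (f : Polynomial ℂ) :
    algebraMap (Polynomial ℂ) (RatFunc ℂ) f ∈ regularAt c := by
  have := algebraMap_div_mem_regularAt (c := c) f (q := 1) (by simp)
  rwa [map_one, div_one] at this

/-- The constants, as rational functions without pole at `c`. -/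
def constAt (c : ℂ) : ℂ →+* regularAt c :=
  (algebraMap ℂ (RatFunc ℂ)).codRestrict (regularAt c) fun x => by
    rw [IsScalarTower.algebraMap_apply ℂ (Polynomial ℂ) (RatFunc ℂ)]
    exact algebraMap_mem_regularAt c _

/-- The variable, as a rational function without pole at `c`. -/
def varAt (c : ℂ) : regularAt c :=
  ⟨RatFunc.X, by
    rw [← RatFunc.algebraMap_X]
    exact algebraMap_mem_regularAt c _⟩

theorem coe_varAt_sub_constAt (c : ℂ) : ((varAt c - constAt c c : regularAt c) : RatFunc ℂ) =
    algebraMap (Polynomial ℂ) (RatFunc ℂ) (Polynomial.X - Polynomial.C c) := by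
  rw [map_sub, RatFunc.algebraMap_X, RatFunc.algebraMap_C]
  rfl

theorem eval₂_algebraMap_X (f : Polynomial ℂ) :
    f.eval₂ (algebraMap ℂ (RatFunc ℂ)) RatFunc.X = algebraMap (Polynomial ℂ) (RatFunc ℂ) f := by
  conv_rhs => rw [← Polynomial.eval₂_C_X (p := f), Polynomial.hom_eval₂, RatFunc.algebraMap_X]
  rfl

theorem eval₂_algebraMap_X_ne_zero (f : Polynomial ℂ) (hf : f ≠ 0) :
    f.eval₂ (algebraMap ℂ (RatFunc ℂ)) RatFunc.X ≠ 0 := by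
  rw [eval₂_algebraMap_X]
  exact RatFunc.algebraMap_ne_zero hf

/-- The group of rational functions which vanish to order at least `d` at `c`. -/
def vanishing (c : ℂ) (d : ℕ) : AddSubgroup (RatFunc ℂ) :=
  (regularAt c).toAddSubgroup.map (AddMonoidHom.mulLeft
    (((varAt c - constAt c c : regularAt c) : RatFunc ℂ) ^ d))

theorem mem_vanishing {c : ℂ} {d : ℕ} {f : RatFunc ℂ} : f ∈ vanishing c d ↔
    ∃ r : regularAt c, f = (((varAt c - constAt c c) ^ d * r : regularAt c) : RatFunc ℂ) := by
  rw [vanishing, AddSubgroup.mem_map]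
  constructor
  · rintro ⟨r, hr, rfl⟩
    exact ⟨⟨r, hr⟩, rfl⟩
  · rintro ⟨r, rfl⟩
    exact ⟨r, r.2, rfl⟩

theorem vanishing_le_of_le {c : ℂ} {d e : ℕ} (h : d ≤ e) : vanishing c e ≤ vanishing c d := by
  intro f hf
  rw [mem_vanishing] at hf ⊢
  obtain ⟨r, rfl⟩ := hf
  obtain ⟨b, rfl⟩ := Nat.exists_eq_add_of_le h
  exact ⟨(varAt c - constAt c c) ^ b * r, by rw [pow_add, mul_assoc]⟩

theorem mem_regularAt_of_mem_vanishing {c : ℂ} {d : ℕ} {f : RatFunc ℂ} (h : f ∈ vanishing c d) :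
    f ∈ regularAt c := by
  obtain ⟨r, rfl⟩ := mem_vanishing.mp h
  exact Subtype.prop _

theorem mul_mem_vanishing {c : ℂ} {d : ℕ} {r f : RatFunc ℂ} (hr : r ∈ regularAt c)
    (h : f ∈ vanishing c d) : r * f ∈ vanishing c d := by
  obtain ⟨r', rfl⟩ := mem_vanishing.mp h
  refine mem_vanishing.mpr ⟨⟨r, hr⟩ * r', ?_⟩
  push_cast
  ring

theorem evalRat_inv (c : ℂ) {q : Polynomial ℂ} (hq : q.eval c ≠ 0) :
    ∃ r : regularAt c, (r : RatFunc ℂ) = (algebraMap (Polynomial ℂ) (RatFunc ℂ) q)⁻¹ ∧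
      evalRat c r ≠ 0 := by
  have hq0 : q ≠ 0 := by
    rintro rfl
    simp at hq
  have hmem := algebraMap_div_mem_regularAt 1 hq
  rw [map_one, one_div] at hmem
  refine ⟨⟨_, hmem⟩, rfl, fun h => ?_⟩
  have h1 : (⟨_, hmem⟩ : regularAt c) * ⟨_, algebraMap_mem_regularAt c q⟩ = 1 :=
    Subtype.ext (inv_mul_cancel₀ (RatFunc.algebraMap_ne_zero hq0))
  have h2 := congrArg (evalRat c) h1
  rw [map_mul, h, zero_mul, map_one] at h2
  exact zero_ne_one h2

/-- Division by a polynomial `f` lowers the order of vanishing by the multiplicity of the root. -/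
theorem exists_eq_mul_of_mul_eq {c : ℂ} {d : ℕ} {f : Polynomial ℂ} (hf : f ≠ 0)
    (hd : f.rootMultiplicity c ≤ d) {g : RatFunc ℂ} {r : regularAt c}
    (h : algebraMap (Polynomial ℂ) (RatFunc ℂ) f * g =
      (((varAt c - constAt c c) ^ d * r : regularAt c) : RatFunc ℂ)) :
    ∃ u : regularAt c, evalRat c u ≠ 0 ∧
      g = (((varAt c - constAt c c) ^ (d - f.rootMultiplicity c) * (u * r) : regularAt c) :
        RatFunc ℂ) := by
  obtain ⟨q, hq, hndvd⟩ := Polynomial.exists_eq_pow_rootMultiplicity_mul_and_not_dvd f hf c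
  rw [Polynomial.dvd_iff_isRoot] at hndvd
  obtain ⟨u, hu, hu0⟩ := evalRat_inv c hndvd
  have hq0 : q ≠ 0 := by
    rintro rfl
    exact hf (by rw [hq, mul_zero])
  have hq0' := RatFunc.algebraMap_ne_zero hq0
  refine ⟨u, hu0, mul_left_cancel₀ (RatFunc.algebraMap_ne_zero hf) ?_⟩
  rw [h]
  generalize f.rootMultiplicity c = e at *
  conv_rhs => rw [hq]
  simp only [Subring.coe_mul, Subring.coe_pow]
  rw [coe_varAt_sub_constAt, hu, map_mul, map_pow]
  obtain ⟨b, rfl⟩ := Nat.exists_eq_add_of_le hd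
  rw [Nat.add_sub_cancel_left, pow_add]
  field_simp

end Vanishing

/-! ## Existence, uniqueness and properties of the Frobenius series -/

section Frobenius

variable {p : ℕ} (hp : 2 ≤ p) {n : ℕ} {a : ℕ → Hahn}

theorem mahlerHahn_C {A : Type*} [CommRing A] (x : A) :
    mahlerHahn p hp A (HahnSeries.C x) = HahnSeries.C x := by
  have hp0 : (p : ℚ) ≠ 0 := by positivity
  ext γ
  rw [coeff_mahlerHahn, HahnSeries.C_apply, HahnSeries.coeff_single, HahnSeries.coeff_single]
  simp [hp0]

theorem mahlerLam_iterate_C_mul_eLam (g : HahnLam) (i : ℕ) :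
    (mahlerLam p hp)^[i] (MvPolynomial.C g * eLam) =
      MvPolynomial.C (HahnSeries.C (RatFunc.X ^ i) * (mahlerHahn p hp (RatFunc ℂ))^[i] g) *
        eLam := by
  induction i with
  | zero => simp
  | succ i ih =>
    rw [Function.iterate_succ_apply', ih, Function.iterate_succ_apply', map_mul]
    have h1 : ∀ f : HahnLam, mahlerLam p hp (MvPolynomial.C f) =
        MvPolynomial.C (mahlerHahn p hp (RatFunc ℂ) f) := fun f => MvPolynomial.eval₂Hom_C _ _ _
    have h2 : mahlerLam p hp eLam = lam * eLam := MvPolynomial.eval₂Hom_X' _ _ _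
    rw [h1, h2, map_mul (mahlerHahn p hp _), mahlerHahn_C, lam, pow_succ, map_mul, map_mul,
      map_mul, map_mul]
    ring

theorem isFrobeniusSeries_iff (c : ℂˣ) (j : ℕ) (g : HahnLam) :
    IsFrobeniusSeries p hp n a c j g ↔
      twistedOp p hp n a (algebraMap ℂ (RatFunc ℂ)) RatFunc.X g =
        HahnSeries.single ((a 0).order - nu p n a j / ((p : ℚ) - 1))
          (((varAt c - constAt c c : regularAt (c : ℂ)) : RatFunc ℂ) ^
            (expShift p n a c j + expMult p n a c j)) := by
  have hl : mahlerApply hahnToRLam (mahlerLam p hp) n a (MvPolynomial.C g * eLam) =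
      MvPolynomial.C (twistedOp p hp n a (algebraMap ℂ (RatFunc ℂ)) RatFunc.X g) * eLam := by
    change _ = MvPolynomial.C (∑ i ∈ Finset.range (n + 1), _) * eLam
    rw [mahlerApply, map_sum, Finset.sum_mul]
    refine Finset.sum_congr rfl fun i _ => ?_
    rw [mahlerLam_iterate_C_mul_eLam, mul_assoc (hahnMap _ _), map_mul _ (hahnMap _ _), mul_assoc]
    rfl
  have hr : ∀ (δ : ℚ) (N : ℕ),
      hahnToRLam (zPow ℂ δ) * (lam - hahnToRLam (HahnSeries.C (c : ℂ))) ^ N =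
        MvPolynomial.C (HahnSeries.single δ
          (((varAt c - constAt c c : regularAt (c : ℂ)) : RatFunc ℂ) ^ N)) := by
    intro δ N
    have h1 : hahnToRLam (zPow ℂ δ) = MvPolynomial.C (HahnSeries.single δ (1 : RatFunc ℂ)) := by
      change MvPolynomial.C (HahnSeries.map _ _) = _
      congr 1
      ext γ
      by_cases h : γ = δ <;> simp [zPow, h]
    have h2 : hahnToRLam (HahnSeries.C (c : ℂ)) =
        MvPolynomial.C (HahnSeries.C (algebraMap ℂ (RatFunc ℂ) c)) := by
      change MvPolynomial.C (HahnSeries.map _ _) = _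
      congr 1
      ext γ
      by_cases h : γ = 0 <;> simp [h]
    have h3 : lam - hahnToRLam (HahnSeries.C (c : ℂ)) = MvPolynomial.C (HahnSeries.C
        ((varAt c - constAt c c : regularAt (c : ℂ)) : RatFunc ℂ)) := by
      rw [h2, lam, AddSubgroupClass.coe_sub, map_sub, map_sub]
      rfl
    rw [h1, h3, ← map_pow, ← map_pow, ← map_mul, mul_comm, HahnSeries.C_mul_eq_smul]
    congr 1
    ext γ
    by_cases h : γ = δ <;> simp [h]
  rw [IsFrobeniusSeries, hl, hr]
  constructor
  · intro h
    exact MvPolynomial.C_injective ℕ HahnLam (mul_right_cancel₀ (MvPolynomial.X_ne_zero 0) h)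
  · intro h
    rw [h]

theorem isFrobeniusSeries_unique (ha : a 0 ≠ 0) {c : ℂˣ} {j : ℕ} {g g' : HahnLam}
    (h : IsFrobeniusSeries p hp n a c j g) (h' : IsFrobeniusSeries p hp n a c j g') : g = g' := by
  rw [isFrobeniusSeries_iff] at h h'
  exact twistedOp_injective hp _ _ ha eval₂_algebraMap_X_ne_zero (h.trans h'.symm)

/-- A lower bound for the order of vanishing at `c` of the coefficient of `z ^ γ` in the Frobenius
series. -/
def orderBound (p n : ℕ) (a : ℕ → Hahn) (c : ℂˣ) (γ : ℚ) : ℕ :=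
  ∑ i ∈ (Finset.Icc 1 (numSlopes p n a)).filter (fun i => γ < -slope p n a i), expMult p n a c i

/-- The left limit at `γ` of the function `orderBound`. -/
def orderBoundLeft (p n : ℕ) (a : ℕ → Hahn) (c : ℂˣ) (γ : ℚ) : ℕ :=
  ∑ i ∈ (Finset.Icc 1 (numSlopes p n a)).filter (fun i => γ ≤ -slope p n a i), expMult p n a c i

theorem orderBoundLeft_le (c : ℂˣ) {γ γ' : ℚ} (h : γ' < γ) :
    orderBoundLeft p n a c γ ≤ orderBound p n a c γ' := by
  refine Finset.sum_le_sum_of_subset fun i hi => ?_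
  rw [Finset.mem_filter] at hi ⊢
  exact ⟨hi.1, h.trans_le hi.2⟩

theorem orderBound_add_rootMultiplicity_le (hp : 2 ≤ p) (ha : a 0 ≠ 0) (c : ℂˣ) {γ δ : ℚ}
    (h : Touches p n a γ δ) :
    orderBound p n a c γ + (charAt p n a γ δ).rootMultiplicity (c : ℂ) ≤
      orderBoundLeft p n a c γ := by
  by_cases h0 : (charAt p n a γ δ).rootMultiplicity (c : ℂ) = 0
  · rw [h0, add_zero]
    refine Finset.sum_le_sum_of_subset fun i hi => ?_
    rw [Finset.mem_filter] at hi ⊢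
    exact ⟨hi.1, hi.2.le⟩
  · obtain ⟨j, hj, hjk, rfl, hm⟩ := rootMultiplicity_charAt hp ha h c h0
    rw [hm, orderBound, add_comm, ← Finset.sum_insert (by simp)]
    refine Finset.sum_le_sum_of_subset fun i hi => ?_
    rw [Finset.mem_insert, Finset.mem_filter] at hi
    rw [Finset.mem_filter]
    rcases hi with rfl | hi
    · exact ⟨Finset.mem_Icc.mpr ⟨hj, hjk⟩, le_rfl⟩
    · exact ⟨hi.1, hi.2.le⟩

theorem orderBoundLeft_slope_le (hp : 2 ≤ p) (ha : a 0 ≠ 0) (han : a n ≠ 0) (c : ℂˣ) {j : ℕ}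
    (hj : 1 ≤ j) :
    orderBoundLeft p n a c (-slope p n a j) ≤ expShift p n a c j + expMult p n a c j := by
  rw [expShift, ← Finset.sum_Ico_succ_top hj]
  refine Finset.sum_le_sum_of_subset fun i hi => ?_
  rw [Finset.mem_filter, Finset.mem_Icc] at hi
  rw [Finset.mem_Ico]
  refine ⟨hi.1.1, ?_⟩
  by_contra! hlt
  have := slope_lt hp ha han hj (by omega : j < i) hi.1.2
  linarith [hi.2]

theorem exists_isFrobeniusSeries (ha : a 0 ≠ 0) (han : a n ≠ 0) (c : ℂˣ) {j : ℕ}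
    (hj : 1 ≤ j) (hjk : j ≤ numSlopes p n a) :
    ∃ g, IsFrobeniusSeries p hp n a c j g ∧ ∀ γ, g.coeff γ ∈ regularAt (c : ℂ) := by
  obtain ⟨g, hg, hE⟩ := exists_twistedOp_eq hp (algebraMap ℂ (RatFunc ℂ)) RatFunc.X ha
    eval₂_algebraMap_X_ne_zero
    (HahnSeries.single ((a 0).order - nu p n a j / ((p : ℚ) - 1))
      (((varAt c - constAt c c : regularAt (c : ℂ)) : RatFunc ℂ) ^
        (expShift p n a c j + expMult p n a c j)))
    (fun γ => vanishing c (orderBound p n a c γ))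
    (fun γ => vanishing c (orderBoundLeft p n a c γ))
    (fun γ x i f hf => mul_mem_vanishing (mul_mem (constAt (c : ℂ) x).2
      (pow_mem (varAt (c : ℂ)).2 i)) hf)
    (fun γ γ' h => vanishing_le_of_le (orderBoundLeft_le c h))
    (fun γ δ h f hf => by
      rw [eval₂_algebraMap_X]
      obtain ⟨r, rfl⟩ := mem_vanishing.mp hf
      have hle := orderBound_add_rootMultiplicity_le hp ha c h
      obtain ⟨u, -, hu⟩ := exists_eq_mul_of_mul_eq h.charAt_ne_zero
        (by omega : (charAt p n a γ δ).rootMultiplicity (c : ℂ) ≤ orderBoundLeft p n a c γ)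
        (mul_div_cancel₀ (((varAt c - constAt c c) ^ orderBoundLeft p n a c γ * r :
          regularAt (c : ℂ)) : RatFunc ℂ) (RatFunc.algebraMap_ne_zero h.charAt_ne_zero))
      refine vanishing_le_of_le (by omega) (mem_vanishing.mpr ⟨u * r, hu⟩))
    (fun γ δ h => by
      by_cases hδ : δ = (a 0).order - nu p n a j / ((p : ℚ) - 1)
      · have ht := (touches_slope hp ha han hj hjk).touches
        rw [← hδ] at ht
        obtain rfl : γ = -slope p n a j := by
          rcases lt_trichotomy γ (-slope p n a j) with hlt | heq | hlt
          · exact absurd (h.lt_of_lt hp ht hlt) (lt_irrefl _)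
          · exact heq
          · exact absurd (ht.lt_of_lt hp h hlt) (lt_irrefl _)
        rw [hδ, HahnSeries.coeff_single_same]
        exact vanishing_le_of_le (orderBoundLeft_slope_le hp ha han c hj)
          (mem_vanishing.mpr ⟨1, by rw [mul_one]; rfl⟩)
      · rw [HahnSeries.coeff_single_of_ne hδ]
        exact zero_mem _)
  exact ⟨g, (isFrobeniusSeries_iff hp c j g).mpr hg,
    fun γ => mem_regularAt_of_mem_vanishing (hE γ)⟩

theorem IsFrobeniusSeries.coeff_mem_regularAt (ha : a 0 ≠ 0) (han : a n ≠ 0) {c : ℂˣ} {j : ℕ}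
    (hj : 1 ≤ j) (hjk : j ≤ numSlopes p n a) {g : HahnLam}
    (hg : IsFrobeniusSeries p hp n a c j g) (γ : ℚ) : g.coeff γ ∈ regularAt (c : ℂ) := by
  obtain ⟨g', hg', hreg⟩ := exists_isFrobeniusSeries hp ha han c hj hjk
  rw [isFrobeniusSeries_unique hp ha hg hg']
  exact hreg γ

theorem IsFrobeniusSeries.leading (ha : a 0 ≠ 0) (han : a n ≠ 0) {c : ℂˣ} {j : ℕ}
    (hj : 1 ≤ j) (hjk : j ≤ numSlopes p n a) {g : HahnLam}
    (hg : IsFrobeniusSeries p hp n a c j g) :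
    g.orderTop = ((-slope p n a j : ℚ) : WithTop ℚ) ∧
      ∃ u : regularAt (c : ℂ), evalRat c u ≠ 0 ∧ g.coeff (-slope p n a j) =
        (((varAt c - constAt c c) ^ expShift p n a c j * u : regularAt (c : ℂ)) : RatFunc ℂ) := by
  have ht := (touches_slope hp ha han hj hjk).touches
  rw [isFrobeniusSeries_iff] at hg
  have h0 : ((varAt c - constAt c c : regularAt (c : ℂ)) : RatFunc ℂ) ^
      (expShift p n a c j + expMult p n a c j) ≠ 0 := by
    rw [coe_varAt_sub_constAt]
    exact pow_ne_zero _ (RatFunc.algebraMap_ne_zero (Polynomial.X_sub_C_ne_zero _))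
  obtain ⟨h1, h2⟩ := order_of_twistedOp_eq_single hp _ _ ha eval₂_algebraMap_X_ne_zero ht h0 hg
  refine ⟨h1, ?_⟩
  have hm : (charAt p n a (-slope p n a j)
      ((a 0).order - nu p n a j / ((p : ℚ) - 1))).rootMultiplicity (c : ℂ) =
        expMult p n a c j := by
    rw [expMult, charPoly_eq_charAt hp ht]
  rw [eval₂_algebraMap_X] at h2
  obtain ⟨u, hu, hu'⟩ := exists_eq_mul_of_mul_eq (r := 1) (d := expShift p n a c j +
    expMult p n a c j) ht.charAt_ne_zero (c := (c : ℂ)) (hm.trans_le (Nat.le_add_left _ _))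
    (h2.trans (by rw [mul_one]; rfl))
  refine ⟨u, hu, ?_⟩
  rw [hu', hm, Nat.add_sub_cancel, mul_one]

end Frobenius

/-! ## Taylor coefficients at `lambda = c` -/

section Taylor

variable (c : ℂ)

/-- The derivation `d / d lambda` on rational functions without pole at `c`. -/
def regDeriv : regularAt c →+ regularAt c :=
  (ratDeriv.comp (regularAt c).subtype.toAddMonoidHom).codRestrict (regularAt c).toAddSubgroup
    fun f => algebraMap_div_mem_regularAt _ (by
      rw [Polynomial.eval_pow]
      exact pow_ne_zero 2 f.2)

variable {c}

theorem regDeriv_mul (f g : regularAt c) :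
    regDeriv c (f * g) = f * regDeriv c g + g * regDeriv c f :=
  Subtype.ext (ratDeriv_mul f g)

theorem ratDeriv_algebraMap (f : Polynomial ℂ) :
    ratDeriv (algebraMap (Polynomial ℂ) (RatFunc ℂ) f) =
      algebraMap (Polynomial ℂ) (RatFunc ℂ) (Polynomial.derivative f) := by
  have h := ratDerivFun_div f 1 one_ne_zero
  simp only [map_one, div_one, mul_one, Polynomial.derivative_one, mul_zero, sub_zero, one_pow]
    at h
  exact h

theorem regDeriv_constAt (x : ℂ) : regDeriv c (constAt c x) = 0 := by
  apply Subtype.ext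
  change ratDeriv (algebraMap ℂ (RatFunc ℂ) x) = 0
  rw [IsScalarTower.algebraMap_apply ℂ (Polynomial ℂ) (RatFunc ℂ), ratDeriv_algebraMap,
    Polynomial.algebraMap_eq, Polynomial.derivative_C, map_zero]

theorem regDeriv_varAt : regDeriv c (varAt c) = 1 := by
  apply Subtype.ext
  change ratDeriv RatFunc.X = 1
  rw [← RatFunc.algebraMap_X, ratDeriv_algebraMap, Polynomial.derivative_X, map_one]

theorem regDeriv_iterate_constAt_mul (x : ℂ) (k : ℕ) (f : regularAt c) :
    (regDeriv c)^[k] (constAt c x * f) = constAt c x * (regDeriv c)^[k] f := by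
  induction k with
  | zero => rfl
  | succ k ih =>
    rw [Function.iterate_succ_apply', ih, regDeriv_mul, regDeriv_constAt, mul_zero, add_zero,
      Function.iterate_succ_apply']

theorem regDeriv_iterate_varAt_mul (k : ℕ) (f : regularAt c) :
    (regDeriv c)^[k + 1] (varAt c * f) =
      varAt c * (regDeriv c)^[k + 1] f + (k + 1 : ℕ) • (regDeriv c)^[k] f := by
  induction k with
  | zero =>
    simp [regDeriv_mul, regDeriv_varAt]
  | succ k ih =>
    rw [Function.iterate_succ_apply', ih, map_add, regDeriv_mul, regDeriv_varAt, map_nsmul,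
      ← Function.iterate_succ_apply' (regDeriv c), ← Function.iterate_succ_apply' (regDeriv c),
      succ_nsmul _ (k + 1), mul_one]
    abel

theorem evalRat_constAt (x : ℂ) : evalRat c (constAt c x) = x := by
  change RatFunc.eval (RingHom.id ℂ) c (algebraMap ℂ (RatFunc ℂ) x) = x
  rw [RatFunc.algebraMap_eq_C, RatFunc.eval_C]
  rfl

theorem evalRat_varAt : evalRat c (varAt c) = c := RatFunc.eval_X (f := RingHom.id ℂ) (a := c)

variable (c) in
/-- The Taylor coefficient of index `k` at `c`. -/
def taylorAt (k : ℕ) : regularAt c →+ ℂ where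
  toFun f := evalRat c ((regDeriv c)^[k] f) / (k.factorial : ℂ)
  map_zero' := by rw [iterate_map_zero, map_zero, zero_div]
  map_add' f g := by rw [iterate_map_add, map_add, add_div]

theorem taylorAt_apply (k : ℕ) (f : regularAt c) :
    taylorAt c k f = evalRat c ((regDeriv c)^[k] f) / (k.factorial : ℂ) := rfl

theorem factorial_mul_taylorAt (k : ℕ) (f : regularAt c) :
    (k.factorial : ℂ) * taylorAt c k f = evalRat c ((regDeriv c)^[k] f) :=
  mul_div_cancel₀ _ (by exact_mod_cast k.factorial_ne_zero)

theorem taylorAt_zero (f : regularAt c) : taylorAt c 0 f = evalRat c f := by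
  simp [taylorAt_apply]

theorem taylorAt_constAt_mul (k : ℕ) (x : ℂ) (f : regularAt c) :
    taylorAt c k (constAt c x * f) = x * taylorAt c k f := by
  rw [taylorAt_apply, regDeriv_iterate_constAt_mul, map_mul, evalRat_constAt, taylorAt_apply,
    mul_div_assoc]

theorem taylorAt_zero_varAt_mul (f : regularAt c) :
    taylorAt c 0 (varAt c * f) = c * taylorAt c 0 f := by
  rw [taylorAt_zero, taylorAt_zero, map_mul, evalRat_varAt]

theorem taylorAt_succ_varAt_mul (k : ℕ) (f : regularAt c) :
    taylorAt c (k + 1) (varAt c * f) = c * taylorAt c (k + 1) f + taylorAt c k f := by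
  have hk : (k.factorial : ℂ) ≠ 0 := by exact_mod_cast k.factorial_ne_zero
  have hk1 : ((k : ℂ) + 1) ≠ 0 := by exact_mod_cast k.succ_ne_zero
  simp only [taylorAt_apply]
  rw [regDeriv_iterate_varAt_mul, map_add, map_mul, evalRat_varAt, map_nsmul, nsmul_eq_mul,
    Nat.factorial_succ]
  push_cast
  field_simp

theorem taylorAt_pow_mul (N k : ℕ) (f : regularAt c) :
    taylorAt c k ((varAt c - constAt c c) ^ N * f) = if N ≤ k then taylorAt c (k - N) f else 0 := by
  induction N generalizing k with
  | zero => simp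
  | succ N ih =>
    rw [pow_succ', mul_assoc, sub_mul, map_sub, taylorAt_constAt_mul]
    cases k with
    | zero =>
      rw [taylorAt_zero_varAt_mul, sub_self, if_neg (by omega)]
    | succ k =>
      rw [taylorAt_succ_varAt_mul, add_sub_cancel_left, ih]
      simp

theorem taylorAt_pow_mul_of_lt {N k : ℕ} (h : k < N) (f : regularAt c) :
    taylorAt c k ((varAt c - constAt c c) ^ N * f) = 0 := by
  rw [taylorAt_pow_mul, if_neg (by omega)]

variable (c) in
/-- The Taylor coefficient of index `k` at `lambda = c` of a Hahn series. -/
def hahnTaylor (k : ℕ) : HahnSeries ℚ (regularAt c) →+ Hahn where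
  toFun g := g.map (taylorAt c k)
  map_zero' := by ext; simp
  map_add' f g := by ext; simp

theorem coeff_hahnTaylor (k : ℕ) (g : HahnSeries ℚ (regularAt c)) (γ : ℚ) :
    (hahnTaylor c k g).coeff γ = taylorAt c k (g.coeff γ) := rfl

theorem hahnTaylor_hahnMap_mul (k : ℕ) (f : Hahn) (g : HahnSeries ℚ (regularAt c)) :
    hahnTaylor c k (hahnMap (constAt c) f * g) = f * hahnTaylor c k g := by
  have h1 : (hahnMap (constAt c) f).support ⊆ f.support := by
    intro γ hγ h0
    apply hγ
    rw [coeff_hahnMap, h0, map_zero]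
  have h2 : (hahnTaylor c k g).support ⊆ g.support := by
    intro γ hγ h0
    apply hγ
    rw [coeff_hahnTaylor, h0, map_zero]
  ext γ
  rw [coeff_hahnTaylor, HahnSeries.coeff_mul_left' f.isPWO_support h1,
    HahnSeries.coeff_mul_right' g.isPWO_support h2, map_sum]
  exact Finset.sum_congr rfl fun ij _ => taylorAt_constAt_mul _ _ _

theorem hahnTaylor_mahlerHahn {p : ℕ} (hp : 2 ≤ p) (k : ℕ) (g : HahnSeries ℚ (regularAt c)) :
    hahnTaylor c k (mahlerHahn p hp _ g) = mahlerHahn p hp ℂ (hahnTaylor c k g) := by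
  ext γ
  rw [coeff_hahnTaylor, coeff_mahlerHahn, coeff_mahlerHahn, coeff_hahnTaylor]

theorem hahnTaylor_zero_C_mul (g : HahnSeries ℚ (regularAt c)) :
    hahnTaylor c 0 (HahnSeries.C (varAt c) * g) = HahnSeries.C c * hahnTaylor c 0 g := by
  ext γ
  rw [HahnSeries.C_mul_eq_smul, HahnSeries.C_mul_eq_smul]
  exact taylorAt_zero_varAt_mul _

theorem hahnTaylor_succ_C_mul (k : ℕ) (g : HahnSeries ℚ (regularAt c)) :
    hahnTaylor c (k + 1) (HahnSeries.C (varAt c) * g) =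
      HahnSeries.C c * hahnTaylor c (k + 1) g + hahnTaylor c k g := by
  ext γ
  rw [HahnSeries.C_mul_eq_smul, HahnSeries.C_mul_eq_smul]
  exact taylorAt_succ_varAt_mul _ _

end Taylor

/-! ## The solutions in an extension of the ring of Hahn series -/

section Solutions

variable {R : Type*} [CommRing R] [Algebra Hahn R] {c : ℂ}

/-- The element `∑ T_k(g) ell_i`, the sum being over `i + k = N`, where `T_k(g)` is the Taylor
coefficient of index `k` of `g` at `lambda = c`. -/
def taylorSum (c : ℂ) (ell : ℕ → R) (N : ℕ) : HahnSeries ℚ (regularAt c) →+ R where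
  toFun g := ∑ ik ∈ Finset.HasAntidiagonal.antidiagonal N,
    algebraMap Hahn R (hahnTaylor c ik.2 g) * ell ik.1
  map_zero' := by simp
  map_add' f g := by simp [add_mul, Finset.sum_add_distrib]

theorem taylorSum_apply (ell : ℕ → R) (N : ℕ) (g : HahnSeries ℚ (regularAt c)) :
    taylorSum c ell N g = ∑ ik ∈ Finset.HasAntidiagonal.antidiagonal N,
      algebraMap Hahn R (hahnTaylor c ik.2 g) * ell ik.1 := rfl

theorem taylorSum_hahnMap_mul (ell : ℕ → R) (N : ℕ) (f : Hahn) (g : HahnSeries ℚ (regularAt c)) :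
    taylorSum c ell N (hahnMap (constAt c) f * g) = algebraMap Hahn R f * taylorSum c ell N g := by
  simp only [taylorSum_apply, hahnTaylor_hahnMap_mul, map_mul, Finset.mul_sum, mul_assoc]

variable {p : ℕ} (hp : 2 ≤ p) {φ : R →+* R} {ell : ℕ → R}

theorem map_taylorSum
    (hφ : ∀ f : Hahn, φ (algebraMap Hahn R f) = algebraMap Hahn R (mahlerHahn p hp ℂ f))
    (hell_zero : φ (ell 0) = algebraMap Hahn R (HahnSeries.C c) * ell 0)
    (hell_succ : ∀ i, φ (ell (i + 1)) =
      algebraMap Hahn R (HahnSeries.C c) * ell (i + 1) + ell i)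
    (N : ℕ) (g : HahnSeries ℚ (regularAt c)) :
    φ (taylorSum c ell N g) =
      taylorSum c ell N (HahnSeries.C (varAt c) * mahlerHahn p hp _ g) := by
  simp only [taylorSum_apply, map_sum, map_mul, hφ, ← hahnTaylor_mahlerHahn]
  generalize mahlerHahn p hp _ g = g'
  cases N with
  | zero =>
    simp only [Finset.Nat.antidiagonal_zero, Finset.sum_singleton, hell_zero, hahnTaylor_zero_C_mul,
      map_mul]
    ring
  | succ N =>
    have h1 : ∑ ik ∈ Finset.HasAntidiagonal.antidiagonal (N + 1),
        algebraMap Hahn R (hahnTaylor c ik.2 g') * φ (ell ik.1) =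
        ∑ ik ∈ Finset.HasAntidiagonal.antidiagonal (N + 1), algebraMap Hahn R (HahnSeries.C c) *
          (algebraMap Hahn R (hahnTaylor c ik.2 g') * ell ik.1) +
        ∑ ik ∈ Finset.HasAntidiagonal.antidiagonal N,
          algebraMap Hahn R (hahnTaylor c ik.2 g') * ell ik.1 := by
      rw [Finset.Nat.sum_antidiagonal_succ, Finset.Nat.sum_antidiagonal_succ, hell_zero, add_assoc,
        ← Finset.sum_add_distrib]
      congr 1
      · ring
      · refine Finset.sum_congr rfl fun ik _ => ?_
        rw [hell_succ]
        ring
    have h2 : ∑ ik ∈ Finset.HasAntidiagonal.antidiagonal (N + 1),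
        algebraMap Hahn R (hahnTaylor c ik.2 (HahnSeries.C (varAt c) * g')) * ell ik.1 =
        ∑ ik ∈ Finset.HasAntidiagonal.antidiagonal (N + 1), algebraMap Hahn R (HahnSeries.C c) *
          (algebraMap Hahn R (hahnTaylor c ik.2 g') * ell ik.1) +
        ∑ ik ∈ Finset.HasAntidiagonal.antidiagonal N,
          algebraMap Hahn R (hahnTaylor c ik.2 g') * ell ik.1 := by
      rw [Finset.Nat.sum_antidiagonal_succ', Finset.Nat.sum_antidiagonal_succ', add_assoc,
        ← Finset.sum_add_distrib]
      dsimp only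
      rw [hahnTaylor_zero_C_mul, map_mul]
      congr 1
      · ring
      · refine Finset.sum_congr rfl fun ik _ => ?_
        rw [hahnTaylor_succ_C_mul, map_add, map_mul]
        ring
    rw [h1, h2]

theorem map_iterate_taylorSum
    (hφ : ∀ f : Hahn, φ (algebraMap Hahn R f) = algebraMap Hahn R (mahlerHahn p hp ℂ f))
    (hell_zero : φ (ell 0) = algebraMap Hahn R (HahnSeries.C c) * ell 0)
    (hell_succ : ∀ i, φ (ell (i + 1)) =
      algebraMap Hahn R (HahnSeries.C c) * ell (i + 1) + ell i)
    (N i : ℕ) (g : HahnSeries ℚ (regularAt c)) :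
    φ^[i] (taylorSum c ell N g) =
      taylorSum c ell N (HahnSeries.C (varAt c ^ i) * (mahlerHahn p hp _)^[i] g) := by
  induction i with
  | zero => simp
  | succ i ih =>
    rw [Function.iterate_succ_apply', ih, map_taylorSum hp hφ hell_zero hell_succ,
      map_mul (mahlerHahn p hp _), mahlerHahn_C, Function.iterate_succ_apply', ← mul_assoc,
      ← map_mul HahnSeries.C, ← pow_succ']

theorem mahlerApply_taylorSum
    (hφ : ∀ f : Hahn, φ (algebraMap Hahn R f) = algebraMap Hahn R (mahlerHahn p hp ℂ f))
    (hell_zero : φ (ell 0) = algebraMap Hahn R (HahnSeries.C c) * ell 0)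
    (hell_succ : ∀ i, φ (ell (i + 1)) =
      algebraMap Hahn R (HahnSeries.C c) * ell (i + 1) + ell i)
    (n : ℕ) (a : ℕ → Hahn) (N : ℕ) (g : HahnSeries ℚ (regularAt c)) :
    mahlerApply (algebraMap Hahn R) φ n a (taylorSum c ell N g) =
      taylorSum c ell N (twistedOp p hp n a (constAt c) (varAt c) g) := by
  change _ = taylorSum c ell N (∑ i ∈ Finset.range (n + 1), _)
  rw [mahlerApply, map_sum]
  refine Finset.sum_congr rfl fun i _ => ?_
  rw [map_iterate_taylorSum hp hφ hell_zero hell_succ, mul_assoc, taylorSum_hahnMap_mul]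

end Solutions

section Derivatives

variable {c : ℂ}

/-- The derivation of Hahn series over the ring of rational functions without pole at `c`. -/
def hahnRegDeriv (c : ℂ) : HahnSeries ℚ (regularAt c) →+ HahnSeries ℚ (regularAt c) where
  toFun g := g.map (regDeriv c)
  map_zero' := by ext; simp
  map_add' f g := by ext; simp

theorem coeff_hahnRegDeriv_iterate (k : ℕ) (g : HahnSeries ℚ (regularAt c)) (γ : ℚ) :
    ((hahnRegDeriv c)^[k] g).coeff γ = (regDeriv c)^[k] (g.coeff γ) := by
  induction k generalizing g with
  | zero => rfl
  | succ k ih =>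
    rw [Function.iterate_succ_apply, ih]
    rfl

theorem hahnMap_hahnRegDeriv_iterate (k : ℕ) (g : HahnSeries ℚ (regularAt c)) :
    hahnMap (regularAt c).subtype ((hahnRegDeriv c)^[k] g) =
      hahnDeriv^[k] (hahnMap (regularAt c).subtype g) := by
  induction k with
  | zero => rfl
  | succ k ih =>
    rw [Function.iterate_succ_apply', Function.iterate_succ_apply', ← ih]
    rfl

/-- The derivative of order `N` of `g e_lambda`, where the coefficients of `g` have no pole
at `c`. -/
def derivAt (c : ℂ) (N : ℕ) (g : HahnSeries ℚ (regularAt c)) : RLamAt c :=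
  ∑ ik ∈ Finset.HasAntidiagonal.antidiagonal N,
    N.choose ik.1 • (MvPolynomial.C ((hahnRegDeriv c)^[ik.2] g) * MvPolynomial.X ik.1)

theorem dLam_iterate_C_mul_eLam (N : ℕ) (g : HahnLam) :
    dLam^[N] (MvPolynomial.C g * eLam) = ∑ ik ∈ Finset.HasAntidiagonal.antidiagonal N,
      N.choose ik.1 • (MvPolynomial.C (hahnDeriv^[ik.2] g) * MvPolynomial.X ik.1 : RLam) := by
  induction N with
  | zero => simp [eLam]
  | succ N ih =>
    rw [Function.iterate_succ_apply', ih, Finset.sum_antidiagonal_choose_succ_nsmul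
      (fun i k => (MvPolynomial.C (hahnDeriv^[k] g) * MvPolynomial.X i : RLam)), map_sum,
      ← Finset.sum_add_distrib]
    refine Finset.sum_congr rfl fun ik hik => ?_
    have hch : N.choose ik.2 = N.choose ik.1 :=
      Nat.choose_symm_of_eq_add (by
        rw [← Finset.HasAntidiagonal.mem_antidiagonal.mp hik, add_comm])
    rw [hch, ← smul_add, map_nsmul, dLam_mul, dLam_X, dLam_C, Function.iterate_succ_apply',
      add_comm, mul_comm (MvPolynomial.X ik.1 : RLam)]

theorem inclAt_derivAt (N : ℕ) (g : HahnSeries ℚ (regularAt c)) :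
    inclAt c (derivAt c N g) =
      dLam^[N] (MvPolynomial.C (hahnMap (regularAt c).subtype g) * eLam) := by
  rw [dLam_iterate_C_mul_eLam, derivAt, map_sum]
  refine Finset.sum_congr rfl fun ik _ => ?_
  have h1 : ∀ f, inclAt c (MvPolynomial.C f) =
      MvPolynomial.C (hahnMap (regularAt c).subtype f) := fun f => MvPolynomial.map_C _ _
  have h2 : ∀ i, inclAt c (MvPolynomial.X i) = MvPolynomial.X i := fun i => MvPolynomial.map_X _ _
  have h3 : inclAt c (MvPolynomial.C ((hahnRegDeriv c)^[ik.2] g) * MvPolynomial.X ik.1) =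
      MvPolynomial.C (hahnDeriv^[ik.2] (hahnMap (regularAt c).subtype g)) *
        MvPolynomial.X ik.1 := by
    rw [map_mul, h1, h2, hahnMap_hahnRegDeriv_iterate]
  rw [← h3]
  exact map_nsmul (inclAt c) _ _

variable {R : Type*} [CommRing R] [Algebra Hahn R]

theorem ev_derivAt (ell : ℕ → R) (N : ℕ) (g : HahnSeries ℚ (regularAt c)) :
    ev c ell (derivAt c N g) = (N.factorial : R) * taylorSum c ell N g := by
  rw [derivAt, map_sum, taylorSum_apply, Finset.mul_sum]
  refine Finset.sum_congr rfl fun ik hik => ?_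
  have h1 : hahnMap (evalRat c) ((hahnRegDeriv c)^[ik.2] g) =
      (ik.2.factorial : Hahn) * hahnTaylor c ik.2 g := by
    ext γ
    rw [coeff_hahnMap, coeff_hahnRegDeriv_iterate, ← factorial_mul_taylorAt,
      ← map_natCast (HahnSeries.C (Γ := ℚ) (R := ℂ)), HahnSeries.C_mul_eq_smul]
    rfl
  have h2 : ik.1 + ik.2 = N := Finset.HasAntidiagonal.mem_antidiagonal.mp hik
  rw [map_nsmul, map_mul, ev, MvPolynomial.eval₂Hom_C, MvPolynomial.eval₂Hom_X', RingHom.comp_apply,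
    h1, map_mul, map_natCast, nsmul_eq_mul, ← h2, Nat.choose_symm_add,
    ← Nat.add_choose_mul_factorial_mul_factorial]
  push_cast
  ring

end Derivatives

/-! ## Linear independence of the elements `ell c i` over the Hahn series -/

section Independence

variable {p : ℕ} (hp : 2 ≤ p)

theorem eq_zero_of_mul_mahlerHahn_eq {c c' : ℂˣ} (hc : c ≠ c') {f : Hahn}
    (h : HahnSeries.C (c : ℂ) * mahlerHahn p hp ℂ f = HahnSeries.C (c' : ℂ) * f) : f = 0 := by
  have hcoeff : ∀ γ, (c : ℂ) * f.coeff (γ / p) = c' * f.coeff γ := by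
    intro γ
    have := congrArg (fun x : Hahn => x.coeff γ) h
    simpa only [HahnSeries.C_mul_eq_smul, HahnSeries.coeff_smul, smul_eq_mul,
      coeff_mahlerHahn] using this
  by_contra hf
  have hne := mt HahnSeries.coeff_order_eq_zero.mp hf
  have hp1 : (1 : ℚ) < p := by exact_mod_cast (by omega : 1 < p)
  have hp0 : (0 : ℚ) < p := by linarith
  rcases lt_trichotomy f.order 0 with hlt | heq | hlt
  · have h1 := hcoeff (f.order * p)
    have hmul : f.order * p < f.order := by nlinarith
    rw [mul_div_cancel_right₀ _ hp0.ne', HahnSeries.coeff_eq_zero_of_lt_order hmul, mul_zero] at h1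
    exact mul_ne_zero c.ne_zero hne h1
  · have h1 := hcoeff 0
    rw [zero_div] at h1
    rw [heq] at hne
    exact hc (Units.ext (mul_right_cancel₀ hne h1))
  · have h1 := hcoeff f.order
    have hdiv : f.order / p < f.order := by
      rw [div_lt_iff₀ hp0]
      nlinarith
    rw [HahnSeries.coeff_eq_zero_of_lt_order hdiv, mul_zero] at h1
    exact mul_ne_zero c'.ne_zero hne h1.symm

theorem mul_mahlerHahn_add_one_ne (x : ℂ) (f : Hahn) :
    HahnSeries.C x * mahlerHahn p hp ℂ f + 1 ≠ HahnSeries.C x * f := by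
  intro h
  have := congrArg (fun y : Hahn => y.coeff 0) h
  simp [coeff_mahlerHahn] at this

variable {R : Type*} [CommRing R] [Algebra Hahn R] {φ : R →+* R} {ell : ℂˣ → ℕ → R}

theorem exists_map_linearCombination_eq
    (hφ : ∀ f : Hahn, φ (algebraMap Hahn R f) = algebraMap Hahn R (mahlerHahn p hp ℂ f))
    (hell_zero : ∀ c : ℂˣ,
      φ (ell c 0) = algebraMap Hahn R (HahnSeries.C (c : ℂ)) * ell c 0)
    (hell_succ : ∀ (c : ℂˣ) (i : ℕ), φ (ell c (i + 1)) =
      algebraMap Hahn R (HahnSeries.C (c : ℂ)) * ell c (i + 1) + ell c i)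
    (v : ℂˣ × ℕ →₀ Hahn) :
    ∃ w : ℂˣ × ℕ →₀ Hahn,
      (∀ c i, w (c, i) = HahnSeries.C (c : ℂ) * mahlerHahn p hp ℂ (v (c, i)) +
        mahlerHahn p hp ℂ (v (c, i + 1))) ∧
      Finsupp.linearCombination Hahn (fun ci : ℂˣ × ℕ => ell ci.1 ci.2) w =
        φ (Finsupp.linearCombination Hahn (fun ci : ℂˣ × ℕ => ell ci.1 ci.2) v) := by
  classical
  induction v using Finsupp.induction_linear with
  | zero => exact ⟨0, by simp, by simp⟩
  | add v v' hv hv' =>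
    obtain ⟨w, hw, hw1⟩ := hv
    obtain ⟨w', hw', hw1'⟩ := hv'
    refine ⟨w + w', fun c i => ?_, by rw [map_add, map_add, map_add, hw1, hw1']⟩
    simp only [Finsupp.add_apply, hw, hw', map_add]
    ring
  | single ci f =>
    obtain ⟨c, i⟩ := ci
    cases i with
    | zero =>
      refine ⟨Finsupp.single (c, 0) (HahnSeries.C (c : ℂ) * mahlerHahn p hp ℂ f), fun c' i => ?_,
        ?_⟩
      · simp only [Finsupp.single_apply, Prod.mk.injEq]
        by_cases hc : c = c'
        · subst hc
          rcases i with _ | i <;> simp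
        · simp [hc]
      · rw [Finsupp.linearCombination_single, Finsupp.linearCombination_single, Algebra.smul_def,
          Algebra.smul_def, map_mul, map_mul, hφ, hell_zero]
        ring
    | succ i =>
      refine ⟨Finsupp.single (c, i + 1) (HahnSeries.C (c : ℂ) * mahlerHahn p hp ℂ f) +
        Finsupp.single (c, i) (mahlerHahn p hp ℂ f), fun c' i' => ?_, ?_⟩
      · simp only [Finsupp.add_apply, Finsupp.single_apply, Prod.mk.injEq]
        by_cases hc : c = c'
        · subst hc
          by_cases hi : i + 1 = i' <;> by_cases hi' : i = i' <;> simp [hi, hi']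
        · simp [hc]
      · rw [map_add, Finsupp.linearCombination_single, Finsupp.linearCombination_single,
          Finsupp.linearCombination_single, Algebra.smul_def, Algebra.smul_def, Algebra.smul_def,
          map_mul, map_mul, hφ, hell_succ]
        ring

theorem eq_zero_of_linearCombination_eq_zero
    (hφ : ∀ f : Hahn, φ (algebraMap Hahn R f) = algebraMap Hahn R (mahlerHahn p hp ℂ f))
    (hell_ne : ∀ c, ell c 0 ≠ 0)
    (hell_zero : ∀ c : ℂˣ,
      φ (ell c 0) = algebraMap Hahn R (HahnSeries.C (c : ℂ)) * ell c 0)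
    (hell_succ : ∀ (c : ℂˣ) (i : ℕ), φ (ell c (i + 1)) =
      algebraMap Hahn R (HahnSeries.C (c : ℂ)) * ell c (i + 1) + ell c i)
    (S : Finset (ℂˣ × ℕ)) (hS : ∀ c i, (c, i + 1) ∈ S → (c, i) ∈ S)
    (v : ℂˣ × ℕ →₀ Hahn) (hvS : ∀ ci, ci ∉ S → v ci = 0)
    (hv : Finsupp.linearCombination Hahn (fun ci : ℂˣ × ℕ => ell ci.1 ci.2) v = 0) : v = 0 := by
  classical
  induction S using Finset.strongInduction generalizing v with
  | H S ih =>
  rcases S.eq_empty_or_nonempty with rfl | hne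
  · ext1 ci
    exact hvS ci (Finset.notMem_empty ci)
  obtain ⟨⟨c₀, N⟩, hmem, hmax⟩ := S.exists_max_image (fun ci => ci.2) hne
  have hN : (c₀, N + 1) ∉ S := fun h => absurd (hmax _ h) (by simp)
  have hS' : ∀ c i, (c, i + 1) ∈ S.erase (c₀, N) → (c, i) ∈ S.erase (c₀, N) := by
    intro c i h
    rw [Finset.mem_erase] at h ⊢
    refine ⟨fun heq => ?_, hS c i h.2⟩
    obtain ⟨rfl, rfl⟩ := Prod.mk.inj heq
    exact hN h.2
  have hrec := ih _ (Finset.erase_ssubset hmem) hS'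
  by_contra hv0
  have htop : v (c₀, N) ≠ 0 := by
    intro htop
    refine hv0 (hrec v (fun ci hci => ?_) hv)
    by_cases heq : ci = (c₀, N)
    · rw [heq, htop]
    · exact hvS ci fun h => hci (Finset.mem_erase.mpr ⟨heq, h⟩)
  set u : ℂˣ × ℕ →₀ Hahn := (v (c₀, N))⁻¹ • v with hu
  have huv : ∀ ci, u ci = (v (c₀, N))⁻¹ * v ci := fun ci => rfl
  have hu1 : u (c₀, N) = 1 := by rw [huv, inv_mul_cancel₀ htop]
  have huS : ∀ ci, ci ∉ S → u ci = 0 := fun ci hci => by rw [huv, hvS ci hci, mul_zero]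
  have hu0 : Finsupp.linearCombination Hahn (fun ci : ℂˣ × ℕ => ell ci.1 ci.2) u = 0 := by
    rw [hu, map_smul, hv, smul_zero]
  obtain ⟨w, hw, hw0⟩ := exists_map_linearCombination_eq hp hφ hell_zero hell_succ u
  rw [hu0, map_zero] at hw0
  have hzero := hrec (w + (-HahnSeries.C (c₀ : ℂ) : Hahn) • u) (fun ci hci => by
    obtain ⟨c, i⟩ := ci
    change w (c, i) + -HahnSeries.C (c₀ : ℂ) * u (c, i) = 0
    rw [hw, neg_mul, ← sub_eq_add_neg]
    by_cases heq : (c, i) = (c₀, N)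
    · obtain ⟨rfl, rfl⟩ := Prod.mk.inj heq
      rw [hu1, huS _ hN, map_one, map_zero, add_zero, sub_self]
    · have hci' : (c, i) ∉ S := fun h => hci (Finset.mem_erase.mpr ⟨heq, h⟩)
      rw [huS _ hci', huS _ fun h => hci' (hS c i h), map_zero, mul_zero, mul_zero, add_zero,
        sub_zero]) (by rw [map_add, map_smul, hw0, hu0, smul_zero, add_zero])
  have key : ∀ (c : ℂˣ) i, HahnSeries.C (c : ℂ) * mahlerHahn p hp ℂ (u (c, i)) +
      mahlerHahn p hp ℂ (u (c, i + 1)) = HahnSeries.C (c₀ : ℂ) * u (c, i) := by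
    intro c i
    rw [← hw, ← sub_eq_zero, sub_eq_add_neg, ← neg_mul]
    exact DFunLike.congr_fun hzero (c, i)
  cases N with
  | succ N =>
    have h := key c₀ N
    rw [hu1, map_one] at h
    exact mul_mahlerHahn_add_one_ne hp _ _ h
  | zero =>
    have hpos : ∀ c i, u (c, i + 1) = 0 := fun c i =>
      huS _ fun h => absurd (hmax _ h) (by simp)
    have hus : u = Finsupp.single (c₀, 0) 1 := by
      ext1 ⟨c, i⟩
      rw [Finsupp.single_apply]
      split_ifs with heq
      · rw [← heq, hu1]
      · cases i with
        | succ i => exact hpos c i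
        | zero =>
          have h := key c 0
          rw [hpos, map_zero, add_zero] at h
          exact eq_zero_of_mul_mahlerHahn_eq hp (fun hc => heq (by rw [hc])) h
    rw [hus, Finsupp.linearCombination_single, one_smul] at hu0
    exact hell_ne c₀ hu0

theorem linearIndependent_ell
    (hφ : ∀ f : Hahn, φ (algebraMap Hahn R f) = algebraMap Hahn R (mahlerHahn p hp ℂ f))
    (hell_ne : ∀ c, ell c 0 ≠ 0)
    (hell_zero : ∀ c : ℂˣ,
      φ (ell c 0) = algebraMap Hahn R (HahnSeries.C (c : ℂ)) * ell c 0)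
    (hell_succ : ∀ (c : ℂˣ) (i : ℕ), φ (ell c (i + 1)) =
      algebraMap Hahn R (HahnSeries.C (c : ℂ)) * ell c (i + 1) + ell c i) :
    LinearIndependent Hahn (fun ci : ℂˣ × ℕ => ell ci.1 ci.2) := by
  classical
  rw [linearIndependent_iff]
  intro v hv
  refine eq_zero_of_linearCombination_eq_zero hp hφ hell_ne hell_zero hell_succ
    (v.support.biUnion fun ci => (Finset.range (ci.2 + 1)).image fun i => (ci.1, i))
    (fun c i h => ?_) v (fun ci hci => ?_) hv
  · simp only [Finset.mem_biUnion, Finset.mem_image, Finset.mem_range] at h ⊢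
    obtain ⟨ci, hci, i', hi', heq⟩ := h
    obtain ⟨rfl, rfl⟩ := Prod.mk.inj heq
    exact ⟨ci, hci, i, by omega, rfl⟩
  · by_contra hne
    refine hci (Finset.mem_biUnion.mpr ⟨ci, Finsupp.mem_support_iff.mpr hne,
      Finset.mem_image.mpr ⟨ci.2, Finset.mem_range.mpr (by omega), rfl⟩⟩)

end Independence

/-! ## The theorem -/

section Final

theorem hahnMap_twistedOp {A B : Type*} [CommRing A] [CommRing B] {p : ℕ} (hp : 2 ≤ p) (n : ℕ)
    (a : ℕ → Hahn) (ι : ℂ →+* A) (l : A) (f : A →+* B) (g : HahnSeries ℚ A) :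
    hahnMap f (twistedOp p hp n a ι l g) = twistedOp p hp n a (f.comp ι) (f l) (hahnMap f g) := by
  change hahnMap f (∑ i ∈ Finset.range (n + 1), _) = ∑ i ∈ Finset.range (n + 1), _
  rw [map_sum]
  refine Finset.sum_congr rfl fun i _ => ?_
  have h1 : hahnMap f (HahnSeries.C (l ^ i)) = HahnSeries.C (f l ^ i) := by
    rw [← map_pow]
    ext γ
    by_cases h : γ = 0 <;> simp [coeff_hahnMap, h]
  have h2 : hahnMap f ((mahlerHahn p hp A)^[i] g) = (mahlerHahn p hp B)^[i] (hahnMap f g) := by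
    ext γ
    rw [coeff_hahnMap, coeff_mahlerHahn_iterate, coeff_mahlerHahn_iterate, coeff_hahnMap]
  rw [map_mul, map_mul, h1, h2]
  rfl

theorem exists_hahnMap_subtype_eq {c : ℂ} {g : HahnLam} (hg : ∀ γ, g.coeff γ ∈ regularAt c) :
    ∃ g' : HahnSeries ℚ (regularAt c), hahnMap (regularAt c).subtype g' = g := by
  refine ⟨⟨fun γ => ⟨g.coeff γ, hg γ⟩, ?_⟩, rfl⟩
  convert g.isPWO_support using 1
  ext γ
  simp [Function.mem_support, ← Subtype.coe_inj]

theorem hahnMap_subtype_injective (c : ℂ) :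
    Function.Injective (hahnMap (regularAt c).subtype) := by
  intro f g h
  ext γ
  exact congrArg (fun x : HahnLam => x.coeff γ) h

theorem taylorSum_single_pow {R : Type*} [CommRing R] [Algebra Hahn R] {c : ℂ} (ell : ℕ → R)
    {N M : ℕ} (h : N < M) (δ : ℚ) :
    taylorSum c ell N (HahnSeries.single δ ((varAt c - constAt c c) ^ M)) = 0 := by
  rw [taylorSum_apply]
  refine Finset.sum_eq_zero fun ik hik => ?_
  have h1 : ik.1 + ik.2 = N := Finset.HasAntidiagonal.mem_antidiagonal.mp hik
  have h2 : hahnTaylor c ik.2 (HahnSeries.single δ ((varAt c - constAt c c) ^ M)) = 0 := by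
    ext γ
    rw [coeff_hahnTaylor]
    by_cases hγ : γ = δ
    · rw [hγ, HahnSeries.coeff_single_same, ← mul_one (_ ^ M),
        taylorAt_pow_mul_of_lt (by omega), HahnSeries.coeff_zero]
    · rw [HahnSeries.coeff_single_of_ne hγ, map_zero, HahnSeries.coeff_zero]
  rw [h2, map_zero, zero_mul]

variable {p : ℕ} (hp : 2 ≤ p) {n : ℕ} {a : ℕ → Hahn}

theorem IsFrobeniusSeries.twistedOp_eq {c : ℂˣ} {j : ℕ} {g : HahnSeries ℚ (regularAt (c : ℂ))}
    (hg : IsFrobeniusSeries p hp n a c j (hahnMap (regularAt (c : ℂ)).subtype g)) :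
    twistedOp p hp n a (constAt c) (varAt c) g =
      HahnSeries.single ((a 0).order - nu p n a j / ((p : ℚ) - 1))
        ((varAt c - constAt c c) ^ (expShift p n a c j + expMult p n a c j)) := by
  apply hahnMap_subtype_injective
  rw [hahnMap_twistedOp]
  refine ((isFrobeniusSeries_iff hp c j _).mp hg).trans ?_
  ext γ
  rw [coeff_hahnMap]
  by_cases hγ : γ = (a 0).order - nu p n a j / ((p : ℚ) - 1)
  · rw [hγ, HahnSeries.coeff_single_same, HahnSeries.coeff_single_same]
    rfl
  · rw [HahnSeries.coeff_single_of_ne hγ, HahnSeries.coeff_single_of_ne hγ, map_zero]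

/-- The coordinates of `taylorSum` on the elements `ell c i`. -/
def taylorVec (c : ℂˣ) (N : ℕ) (g : HahnSeries ℚ (regularAt (c : ℂ))) : ℂˣ × ℕ →₀ Hahn :=
  ∑ ik ∈ Finset.HasAntidiagonal.antidiagonal N, Finsupp.single (c, ik.1) (hahnTaylor c ik.2 g)

theorem linearCombination_taylorVec {R : Type*} [CommRing R] [Algebra Hahn R]
    (ell : ℂˣ → ℕ → R) (c : ℂˣ) (N : ℕ) (g : HahnSeries ℚ (regularAt (c : ℂ))) :
    Finsupp.linearCombination Hahn (fun ci : ℂˣ × ℕ => ell ci.1 ci.2) (taylorVec c N g) =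
      taylorSum c (ell c) N g := by
  simp only [taylorVec, map_sum, Finsupp.linearCombination_single, Algebra.smul_def,
    taylorSum_apply]

theorem taylorVec_apply (c : ℂˣ) (N : ℕ) (g : HahnSeries ℚ (regularAt (c : ℂ))) (i : ℕ) :
    taylorVec c N g (c, i) = if i ≤ N then hahnTaylor c (N - i) g else 0 := by
  rw [taylorVec, Finsupp.finsetSum_apply, Finset.Nat.sum_antidiagonal_eq_sum_range_succ_mk]
  simp only [Finsupp.single_apply, Prod.mk.injEq, true_and, Finset.sum_ite_eq', Finset.mem_range,
    Nat.lt_succ_iff]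

theorem taylorVec_apply_of_ne {c c' : ℂˣ} (hc : c ≠ c') (N : ℕ)
    (g : HahnSeries ℚ (regularAt (c : ℂ))) (i : ℕ) : taylorVec c N g (c', i) = 0 := by
  rw [taylorVec, Finsupp.finsetSum_apply]
  refine Finset.sum_eq_zero fun ik _ => ?_
  rw [Finsupp.single_apply, if_neg fun h => hc (Prod.mk.inj h).1]

/-- A family of elements whose coordinates have leading terms in triangular position with respect to
the lexicographic order on pairs `(j, m)` is linearly independent. -/
theorem linearIndependent_taylorSum {R : Type*} [CommRing R] [Algebra Hahn R] [Algebra ℂ R]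
    (hC : ∀ x : ℂ, algebraMap ℂ R x = algebraMap Hahn R (HahnSeries.C x)) {ell : ℂˣ → ℕ → R}
    (hell : LinearIndependent Hahn (fun ci : ℂˣ × ℕ => ell ci.1 ci.2))
    {I : Set (ℂˣ × ℕ × ℕ)} (s : ℂˣ → ℕ → ℕ) (ρ : ℕ → ℚ)
    (hρ : ∀ t ∈ I, ∀ t' ∈ I, t.2.1 < t'.2.1 → ρ t'.2.1 < ρ t.2.1)
    (g : ∀ t : I, HahnSeries ℚ (regularAt (t.1.1 : ℂ)))
    (hg : ∀ t : I, ∀ γ < ρ t.1.2.1, (g t).coeff γ = 0)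
    (hlead : ∀ t : I, ∃ u : regularAt (t.1.1 : ℂ), evalRat t.1.1 u ≠ 0 ∧ (g t).coeff (ρ t.1.2.1) =
      (varAt (t.1.1 : ℂ) - constAt (t.1.1 : ℂ) t.1.1) ^ s t.1.1 t.1.2.1 * u) :
    LinearIndependent ℂ (fun t : I => ((s t.1.1 t.1.2.1 + t.1.2.2).factorial : R) *
      taylorSum t.1.1 (ell t.1.1) (s t.1.1 t.1.2.1 + t.1.2.2) (g t)) := by
  classical
  rw [linearIndependent_iff']
  intro S x hx
  by_contra! hne
  obtain ⟨t₁, ht₁, hxt₁⟩ := hne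
  obtain ⟨t₀, ht₀, hmax⟩ := (S.filter fun t => x t ≠ 0).exists_max_image
    (fun t => toLex (t.1.2.1, t.1.2.2)) ⟨t₁, Finset.mem_filter.mpr ⟨ht₁, hxt₁⟩⟩
  obtain ⟨ht₀S, hxt₀⟩ := Finset.mem_filter.mp ht₀
  set N : I → ℕ := fun t => s t.1.1 t.1.2.1 + t.1.2.2 with hN
  have hsum : ∑ t ∈ S, (HahnSeries.C (x t * ((N t).factorial : ℂ)) : Hahn) •
      taylorVec t.1.1 (N t) (g t) = 0 := by
    rw [linearIndependent_iff] at hell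
    apply hell
    rw [map_sum, ← hx]
    refine Finset.sum_congr rfl fun t _ => ?_
    rw [map_smul, linearCombination_taylorVec, Algebra.smul_def, Algebra.smul_def, hC, map_mul,
      map_mul, map_natCast, map_natCast, mul_assoc]
  have hcoeff : ∑ t ∈ S, x t * ((N t).factorial : ℂ) *
      (taylorVec t.1.1 (N t) (g t) (t₀.1.1, t₀.1.2.2)).coeff (ρ t₀.1.2.1) = 0 := by
    have h1 := congrArg (fun v : ℂˣ × ℕ →₀ Hahn => (v (t₀.1.1, t₀.1.2.2)).coeff (ρ t₀.1.2.1)) hsum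
    rw [Finsupp.coe_zero, Pi.zero_apply, HahnSeries.coeff_zero, Finsupp.finsetSum_apply,
      HahnSeries.coeff_sum] at h1
    rw [← h1]
    refine Finset.sum_congr rfl fun t _ => ?_
    change _ = (HahnSeries.C (x t * ((N t).factorial : ℂ)) *
      taylorVec t.1.1 (N t) (g t) (t₀.1.1, t₀.1.2.2)).coeff (ρ t₀.1.2.1)
    rw [HahnSeries.C_mul_eq_smul, HahnSeries.coeff_smul, smul_eq_mul]
  rw [Finset.sum_eq_single_of_mem t₀ ht₀S] at hcoeff
  · obtain ⟨u, hu, hgu⟩ := hlead t₀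
    rw [taylorVec_apply, if_pos (Nat.le_add_left _ _), Nat.add_sub_cancel, coeff_hahnTaylor, hgu,
      taylorAt_pow_mul, if_pos le_rfl, Nat.sub_self, taylorAt_zero] at hcoeff
    exact mul_ne_zero (mul_ne_zero hxt₀ (by exact_mod_cast (N t₀).factorial_ne_zero)) hu hcoeff
  · intro t ht hne
    by_cases hxt : x t = 0
    · rw [hxt, zero_mul, zero_mul]
    suffices h : (taylorVec t.1.1 (N t) (g t) (t₀.1.1, t₀.1.2.2)).coeff (ρ t₀.1.2.1) = 0 by
      rw [h, mul_zero]
    by_cases hc : t.1.1 = t₀.1.1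
    · rw [← hc, taylorVec_apply]
      split_ifs with hle
      · rw [coeff_hahnTaylor]
        have hlex := hmax t (Finset.mem_filter.mpr ⟨ht, hxt⟩)
        rw [Prod.Lex.toLex_le_toLex] at hlex
        rcases hlex with hlt | ⟨heq, hle'⟩
        · rw [hg t _ (hρ t.1 t.2 t₀.1 t₀.2 hlt), map_zero]
        · dsimp only at heq hle'
          have hm : t.1.2.2 ≠ t₀.1.2.2 := fun hm =>
            hne (Subtype.ext (Prod.ext hc (Prod.ext heq hm)))
          obtain ⟨u, -, hgu⟩ := hlead t
          rw [← heq, hgu]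
          refine taylorAt_pow_mul_of_lt ?_ u
          simp only [hN] at hle ⊢
          omega
      · rfl
    · rw [taylorVec_apply_of_ne hc, HahnSeries.coeff_zero]

end Final

end MahlerFrobenius

end

theorem mainTheorem1 (p : ℕ) (hp : 2 ≤ p) (n : ℕ) (a : ℕ → MahlerFrobenius.Hahn)
    (ha0 : a 0 ≠ 0) (han : a n ≠ 0)
    {R : Type*} [CommRing R] [Algebra MahlerFrobenius.Hahn R] [Algebra ℂ R]
    (hC : ∀ x : ℂ,
      algebraMap ℂ R x = algebraMap MahlerFrobenius.Hahn R (HahnSeries.C x))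
    (φ : R →+* R)
    (hφ : ∀ f : MahlerFrobenius.Hahn,
      φ (algebraMap MahlerFrobenius.Hahn R f) =
        algebraMap MahlerFrobenius.Hahn R (MahlerFrobenius.mahlerHahn p hp ℂ f))
    (ell : ℂˣ → ℕ → R)
    (hell_ne : ∀ c i, ell c i ≠ 0)
    (hell_zero : ∀ c : ℂˣ, φ (ell c 0) = (c : ℂ) • ell c 0)
    (hell_succ : ∀ (c : ℂˣ) (i : ℕ), φ (ell c (i + 1)) = (c : ℂ) • ell c (i + 1) + ell c i) :
    (∀ j, 1 ≤ j → j ≤ MahlerFrobenius.numSlopes p n a → ∀ c : ℂˣ,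
      MahlerFrobenius.IsExponent p n a c j →
        ∃! g : MahlerFrobenius.HahnLam, MahlerFrobenius.IsFrobeniusSeries p hp n a c j g) ∧
    ∀ g : ℂˣ → ℕ → MahlerFrobenius.HahnLam,
      (∀ j, 1 ≤ j → j ≤ MahlerFrobenius.numSlopes p n a → ∀ c : ℂˣ,
        MahlerFrobenius.IsExponent p n a c j →
          MahlerFrobenius.IsFrobeniusSeries p hp n a c j (g c j)) →
      (∀ j, 1 ≤ j → j ≤ MahlerFrobenius.numSlopes p n a → ∀ c : ℂˣ,
        MahlerFrobenius.IsExponent p n a c j →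
          (g c j).orderTop = ((-MahlerFrobenius.slope p n a j : ℚ) : WithTop ℚ) ∧
          ∀ γ : ℚ, (g c j).coeff γ ∈ MahlerFrobenius.regularAt (c : ℂ)) ∧
      ∃ Y : ∀ t : MahlerFrobenius.frobeniusIndex p n a, MahlerFrobenius.RLamAt (t.1.1 : ℂ),
        (∀ t, MahlerFrobenius.inclAt (t.1.1 : ℂ) (Y t) =
          MahlerFrobenius.dLam^[MahlerFrobenius.expShift p n a t.1.1 t.1.2.1 + t.1.2.2]
            (MvPolynomial.C (g t.1.1 t.1.2.1) * MahlerFrobenius.eLam)) ∧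
        (∀ t, MahlerFrobenius.mahlerApply (algebraMap MahlerFrobenius.Hahn R) φ n a
          (MahlerFrobenius.ev (t.1.1 : ℂ) (ell t.1.1) (Y t)) = 0) ∧
        LinearIndependent ℂ (fun t : MahlerFrobenius.frobeniusIndex p n a =>
          MahlerFrobenius.ev (t.1.1 : ℂ) (ell t.1.1) (Y t)) ∧
        (MahlerFrobenius.frobeniusIndex p n a).encard = n := by
  have hell_zero' : ∀ c : ℂˣ,
      φ (ell c 0) = algebraMap MahlerFrobenius.Hahn R (HahnSeries.C (c : ℂ)) * ell c 0 :=
    fun c => by rw [hell_zero, Algebra.smul_def, hC]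
  have hell_succ' : ∀ (c : ℂˣ) (i : ℕ), φ (ell c (i + 1)) =
      algebraMap MahlerFrobenius.Hahn R (HahnSeries.C (c : ℂ)) * ell c (i + 1) + ell c i :=
    fun c i => by rw [hell_succ, Algebra.smul_def, hC]
  refine ⟨fun j hj hjk c _ => ?_, fun g hg => ⟨fun j hj hjk c hc => ⟨?_, ?_⟩, ?_⟩⟩
  · obtain ⟨g, hg, -⟩ := MahlerFrobenius.exists_isFrobeniusSeries hp ha0 han c hj hjk
    exact ⟨g, hg, fun g' hg' => MahlerFrobenius.isFrobeniusSeries_unique hp ha0 hg' hg⟩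
  · exact ((hg j hj hjk c hc).leading hp ha0 han hj hjk).1
  · exact (hg j hj hjk c hc).coeff_mem_regularAt hp ha0 han hj hjk
  have hgt : ∀ t : MahlerFrobenius.frobeniusIndex p n a,
      MahlerFrobenius.IsFrobeniusSeries p hp n a t.1.1 t.1.2.1 (g t.1.1 t.1.2.1) :=
    fun t => hg _ t.2.1 t.2.2.1 _ t.2.2.2.1
  choose g' hg' using fun t : MahlerFrobenius.frobeniusIndex p n a =>
    MahlerFrobenius.exists_hahnMap_subtype_eq
      ((hgt t).coeff_mem_regularAt hp ha0 han t.2.1 t.2.2.1)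
  refine ⟨fun t => MahlerFrobenius.derivAt t.1.1
    (MahlerFrobenius.expShift p n a t.1.1 t.1.2.1 + t.1.2.2) (g' t), fun t => ?_, fun t => ?_, ?_,
    MahlerFrobenius.encard_frobeniusIndex hp ha0 han⟩
  · rw [MahlerFrobenius.inclAt_derivAt, hg']
  · have hgt' := hgt t
    rw [← hg' t] at hgt'
    rw [MahlerFrobenius.ev_derivAt, ← nsmul_eq_mul, ← map_nsmul,
      MahlerFrobenius.mahlerApply_taylorSum hp hφ (hell_zero' _) (hell_succ' _), map_nsmul,
      map_nsmul, hgt'.twistedOp_eq hp, MahlerFrobenius.taylorSum_single_pow _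
        (Nat.add_lt_add_left t.2.2.2.2 _), smul_zero]
  · simp only [MahlerFrobenius.ev_derivAt]
    refine MahlerFrobenius.linearIndependent_taylorSum hC
      (MahlerFrobenius.linearIndependent_ell hp hφ (fun c => hell_ne c 0) hell_zero' hell_succ')
      (MahlerFrobenius.expShift p n a) (fun j => -MahlerFrobenius.slope p n a j)
      (fun t ht t' ht' hlt => neg_lt_neg
        (MahlerFrobenius.slope_lt hp ha0 han ht.1 hlt ht'.2.1)) g' (fun t γ hγ => ?_) fun t => ?_
    · apply Subtype.ext
      have h1 := ((hgt t).leading hp ha0 han t.2.1 t.2.2.1).1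
      rw [← hg' t] at h1
      exact HahnSeries.coeff_eq_zero_of_lt_orderTop (by rw [h1]; exact_mod_cast hγ)
    · obtain ⟨u, hu, hgu⟩ := ((hgt t).leading hp ha0 han t.2.1 t.2.2.1).2
      rw [← hg' t] at hgu
      exact ⟨u, hu, Subtype.ext hgu⟩
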